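/- Let $d\in\mathbb N$ and let $p,q\in[1,\infty]$ with $1/p+1/q=1$. For $\gamma>0$ and $0\le\eta<1/2$ define the clipped linear link $$u(s)=\begin{cases}\eta & s<-\gamma\\ \frac{1-2\eta}{2\gamma}s+\frac12 & -\gamma\le s\le\gamma\\ 1-\eta & s>\gamma\end{cases}$$ and, for $w,x\in\mathbb R^d$ and $y\in\{-1,1\}$, the surrogate loss $$\ell(w,(x,y))=\int_0^{\langle w,x\rangle}\Bigl(u(s)-\tfrac{y+1}{2}\Bigr)\,ds ,$$ where $\tfrac{y+1}{2}\in\{0,1\}$ is the label transformed from $\{\pm1\}$ to $\{0,1\}$. Then $w\mapsto \ell(w,(x,y))$ is convex. Let $\mathcal D_x$ be a probability distribution on $\{x\in\mathbb R^d:\|x\|_p\le1\}$ and let $w^*\in\mathbb R^d$ with $\|w^*\|_q=1$ satisfy $\Pr_{x\sim\mathcal D_x}[|\langle w^*,x\rangle|>\gamma]=1$. Let $\mathcal D$ be the law of $(x,y)$, where $x\sim\mathcal D_x$ and, given $x$, $y=\mathrm{sign}\langle w^*,x\rangle$ with probability $1-\eta$ and $y=-\mathrm{sign}\langle w^*,x\rangle$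 with probability $\eta$. Consider Stochastic Mirror Descent with a constant step size $a>0$ for $$\min_{\|w\|_q\le1}\ \mathbb E_{(x,y)\sim\mathcal D}\,[\ell(w,(x,y))],$$ run for $T$ iterations on i.i.d. samples $z_0,\dots,z_{T-1}\sim\mathcal D$, with updates $$w_{k+1}=\Pi^\psi_{K}\bigl((\nabla\psi)^{-1}(\nabla\psi(w_k)-a\,\nabla_w\ell(w_k,z_k))\bigr),$$ where $\Pi^\psi_K$ is the Bregman projection, started at the minimizer of $\psi$ over $K$, and returning the average $w=\frac1T\sum_{k<T}w_k$. Here $K=\{\|w\|_q\le1\}$, with $\psi=\frac12\|\cdot\|_q^2$ if $1<q<\infty$ and $\psi=\frac12\|\cdot\|_2^2$ if $q=\infty$. If $q=1$, the method is run with the entropy $\psi(v)=\sum_i v_i\log v_i$ on the probability simplex of $\mathbb R^{2d}$, each $v=(v^+,v^-)$ representing $w=v^+-v^-$. Then there is a constant $C>0$ depending only on $d$ and $q$ such that for all $\gamma>0$, $0\le\eta<1/2$, $\varepsilon>0$, $\delta\in(0,1)$ and all $$T\ \ge\ \frac{C\log(2/\delta)}{(\varepsilon\gamma(1-2\eta))^{r}},\qquad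 r=\begin{cases}\max(2,q) & q<\infty\\ 2 & q=\infty,\end{cases}$$ there is a step size $a>0$ such that, for all $\mathcal D_x$ and $w^*$ as above, with probability at least $1-\delta$ the returned halfspace $w$ satisfies $\|w\|_q\le1$ and $$\mathbb E_{(x,y)\sim\mathcal D}\bigl[\mathbf 1\{y\langle w,x\rangle\le\gamma/2\}\bigr]\le\eta+\varepsilon .$$ -/

import Mathlib

open MeasureTheory ProbabilityTheory
open scoped ENNReal

noncomputable section

namespace RobustHalfspace

/-- The instance space `ℝᵈ`. Its `inner` is the dot product; other norms are given by `vecNorm`. -/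
abbrev E (ι : Type) : Type := EuclideanSpace ℝ ι

/-- The `ℓ_q` norm on `ℝ^ι`, for `q ∈ [1, ∞]`. -/
def vecNorm {ι : Type} [Fintype ι] (q : ℝ≥0∞) (w : E ι) : ℝ :=
  ‖(WithLp.toLp q (WithLp.ofLp w) : PiLp q (fun _ : ι => ℝ))‖

/-! ### The data distribution -/

/-- The halfspace `h_w(x) = sign ⟨w, x⟩`. -/
def halfspace {d : ℕ} (w x : E (Fin d)) : ℝ := Real.sign (inner ℝ w x)

/-- The law of a noisy example `(x, y)`: `x ∼ Dx`, and `y = h_w(x)` with probability `1 - η`,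
`y = -h_w(x)` with probability `η`. -/
def noisyExample {d : ℕ} (Dx : Measure (E (Fin d))) (w : E (Fin d)) (η : ℝ) :
    Measure (E (Fin d) × ℝ) :=
  ENNReal.ofReal (1 - η) • Dx.map (fun x => (x, halfspace w x)) +
    ENNReal.ofReal η • Dx.map (fun x => (x, -halfspace w x))

/-- The `τ`-margin misclassification error `E_{(x,y)∼D} 1{y⟨w, x⟩ ≤ τ}`. -/
def marginError {d : ℕ} (D : Measure (E (Fin d) × ℝ)) (τ : ℝ) (w : E (Fin d)) : ℝ :=
  D.real {z | z.2 * inner ℝ w z.1 ≤ τ}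

/-! ### The convex surrogate -/

/-- The clipped linear link function. -/
def link (γ η s : ℝ) : ℝ :=
  if s < -γ then η
  else if s ≤ γ then (1 - 2 * η) / (2 * γ) * s + 1 / 2
  else 1 - η

/-- The surrogate `ℓ(w, (x, y)) = ∫_0^{⟨w, x⟩} (u(s) - y') ds`, where `y' = (y + 1) / 2 ∈ {0, 1}` is
the transformed label of `y ∈ {-1, 1}`. -/
def glmLoss {d : ℕ} (γ η : ℝ) (w : E (Fin d)) (z : E (Fin d) × ℝ) : ℝ :=
  ∫ s in (0 : ℝ)..(inner ℝ w z.1), (link γ η s - (z.2 + 1) / 2)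

/-! ### Stochastic mirror descent -/

section MirrorDescent

variable {F Z : Type} [NormedAddCommGroup F] [InnerProductSpace ℝ F] [CompleteSpace F]

/-- The Bregman divergence `D_ψ(w, y) = ψ(w) - ψ(y) - ⟨∇ψ(y), w - y⟩`. -/
def bregman (ψ : F → ℝ) (w y : F) : ℝ :=
  ψ w - ψ y - inner ℝ (gradient ψ y) (w - y)

/-- The Bregman projection `Π_K^ψ(y) = argmin_{w ∈ K ∩ dom} D_ψ(w, y)`, where `dom` is the (open)
domain of the potential. -/
def bregmanProj (ψ : F → ℝ) (dom K : Set F) (y : F) : F :=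
  Classical.epsilon fun w => w ∈ K ∩ dom ∧ ∀ v ∈ K ∩ dom, bregman ψ w y ≤ bregman ψ v y

/-- One mirror descent step `Π_K^ψ((∇ψ)⁻¹(∇ψ(w) - a g))` with step size `a`; `∇ψ` is inverted on
the domain of `ψ`. -/
def mirrorStep (ψ : F → ℝ) (dom K : Set F) (a : ℝ) (w g : F) : F :=
  bregmanProj ψ dom K (Function.invFunOn (gradient ψ) dom (gradient ψ w - a • g))

/-- The iterates of stochastic mirror descent for `min_{w ∈ K} E_z f(w, z)` on the samples
`z 0, z 1, …`: the stochastic gradient used at iteration `k` is `∇_w f(w_k, z k)`. -/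
def smdIterate (ψ : F → ℝ) (dom K : Set F) (w₀ : F) (a : ℝ) (f : F → Z → ℝ) (z : ℕ → Z) : ℕ → F
  | 0 => w₀
  | k + 1 =>
    let w := smdIterate ψ dom K w₀ a f z k
    mirrorStep ψ dom K a w (gradient (fun v => f v (z k)) w)

/-- The output of stochastic mirror descent after `T` iterations: the average of the iterates. -/
def smdAverage (ψ : F → ℝ) (dom K : Set F) (w₀ : F) (a : ℝ) (f : F → Z → ℝ) (T : ℕ) (z : ℕ → Z) :
    F :=
  (T : ℝ)⁻¹ • ∑ k ∈ Finset.range T, smdIterate ψ dom K w₀ a f z k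

end MirrorDescent

/-- The potential `ψ(w) = ‖w‖_r² / 2`. -/
def lpPotential {ι : Type} [Fintype ι] (r : ℝ≥0∞) (w : E ι) : ℝ := vecNorm r w ^ 2 / 2

/-- The entropy potential `ψ(w) = ∑ w_i log w_i`. -/
def entropyPotential {ι : Type} [Fintype ι] (w : E ι) : ℝ := ∑ i, w i * Real.log (w i)

/-- The unit ball of the `ℓ_q` norm. -/
def lpUnitBall {ι : Type} [Fintype ι] (q : ℝ≥0∞) : Set (E ι) := {w | vecNorm q w ≤ 1}

/-- The probability simplex. -/
def simplex (ι : Type) [Fintype ι] : Set (E ι) := {v | (∀ i, 0 ≤ v i) ∧ ∑ i, v i = 1}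

/-- The open positive orthant, the domain of the entropy potential. -/
def posOrthant (ι : Type) : Set (E ι) := {v | ∀ i, 0 < v i}

/-- The uniform distribution, the minimizer of the entropy potential on the simplex. -/
def uniformPoint (ι : Type) [Fintype ι] : E ι := WithLp.toLp 2 fun _ => (Fintype.card ι : ℝ)⁻¹

/-- The map `(v⁺, v⁻) ↦ v⁺ - v⁻`, which for `d ≥ 1` sends the simplex of `ℝ²ᵈ` onto the `ℓ_1` unit
ball of `ℝᵈ`. -/
def signedPart {d : ℕ} (v : E (Fin d ⊕ Fin d)) : E (Fin d) :=
  WithLp.toLp 2 fun i => v (Sum.inl i) - v (Sum.inr i)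

/-- `T` iterations of stochastic mirror descent with step size `a` on the problem
`min_{‖w‖_q ≤ 1} E_{(x,y)∼D} ℓ(w, (x, y))`, run on the samples `z 0, …, z (T - 1)`.
For `1 < q < ∞` the potential is `‖w‖_q² / 2`, started at its minimizer `0`. For `q = 1` it is the
entropy, on the simplex of `ℝ²ᵈ` that represents the `ℓ_1` ball. For `q = ∞`, where `‖w‖_q²` is not
differentiable, it is `‖w‖_2² / 2`. -/
def smdHalfspace {d : ℕ} (q : ℝ≥0∞) (γ η a : ℝ) (T : ℕ) (z : ℕ → E (Fin d) × ℝ) : E (Fin d) :=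
  if q = 1 then
    signedPart (smdAverage entropyPotential (posOrthant (Fin d ⊕ Fin d)) (simplex (Fin d ⊕ Fin d))
      (uniformPoint (Fin d ⊕ Fin d)) a (fun v => glmLoss γ η (signedPart v)) T z)
  else
    smdAverage (lpPotential (if q = ∞ then 2 else q)) Set.univ (lpUnitBall q) 0 a
      (glmLoss γ η) T z

/-- The exponent of the sample size: `2` for `1 ≤ q ≤ 2` and for `q = ∞`, and `q` for
`2 < q < ∞`. -/
def rateExponent (q : ℝ≥0∞) : ℝ := if q = ∞ then 2 else max 2 q.toReal

end RobustHalfspace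

end

/-! The loss is that of a well-specified generalized linear model. Put `s = ⟨w, x⟩` and `t = ⟨w*,
x⟩`, and say `t > γ`. The transformed label has conditional mean `1 - η = u(t)`, so the directional
derivative of the loss at `w` along `w - w*` has conditional mean `(u(s) - (1 - η)) (s - t)`. This
is nonnegative and dominates the hinge `(1 - 2η) max(0, 3γ/8 - s/2)` (`hinge_le_directionalLoss`).
The hinge is convex in `w` and at least `(1 - 2η)γ/8` as soon as `s ≤ γ/2`. Hence if the iterates
have average expected directional derivative at most `ε γ (1 - 2η)/8`, Jensen's inequality for the
averaged iterate and Markov's inequality bound its noiseless margin error by `ε`. Label noise adds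
at most `η` (`marginError_average_le`).

The sum of the directional derivatives along the actual samples is the linearized regret of mirror
descent. The three-point identity bounds one step by a telescoping difference of divergences plus `a
⟨g, w - y⟩`, where `y` is the unprojected point (`mirror_step_regret`). No strong convexity is used:
`w - y` is small because the inverse mirror map is Hölder continuous. For `1 < q < ∞` that map is
the duality map of `ℓ_p`, with exponent `t = min 1 (p - 1)`. The regret is then at most `D / a + T M
a ^ t` (`exists_isRegretBounded`), and balancing the terms gives sample size of order `x ^ -(1 +
1/t)` for accuracy `x`. Here `1 + 1/t = max 2 q`, because `1 / (p - 1) = q - 1`. The entropy (`q =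
1`) and Euclidean (`q = ∞`) cases have `t = 1`.

Each iterate depends on earlier samples only, so an Azuma–Hoeffding argument compares the sampled
sum with the sum of expectations (`measure_not_small_loss_le`). `exists_step_size` then fixes the
step size and the constant. -/

namespace RobustHalfspace

/-! ### The link function and the surrogate loss -/

/-- In the clamped form, continuity and monotonicity are immediate and case distinctions on `s`
become computations with `min` and `max`. -/
lemma link_eq_clamp {γ η : ℝ} (hγ : 0 < γ) (s : ℝ) :
    link γ η s = (1 - 2 * η) / (2 * γ) * max (-γ) (min γ s) + 1 / 2 := by
  unfold link
  split_ifs with h₁ h₂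
  · rw [min_eq_right (by linarith), max_eq_left h₁.le]
    field_simp
    ring
  · rw [min_eq_right h₂, max_eq_right (not_lt.1 h₁)]
  · rw [min_eq_left (not_le.1 h₂).le, max_eq_right (by linarith)]
    field_simp
    ring

lemma continuous_link {γ : ℝ} (η : ℝ) (hγ : 0 < γ) : Continuous (link γ η) := by
  rw [funext (link_eq_clamp (η := η) hγ)]
  fun_prop

lemma link_monotone {γ η : ℝ} (hγ : 0 < γ) (hη : η < 1 / 2) : Monotone (link γ η) := by
  intro s t hst
  rw [link_eq_clamp hγ, link_eq_clamp hγ]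
  have : 0 ≤ (1 - 2 * η) / (2 * γ) := by
    apply div_nonneg <;> linarith
  gcongr

lemma link_mem_Icc {γ η : ℝ} (hγ : 0 < γ) (hη₀ : 0 ≤ η) (hη : η < 1 / 2) (s : ℝ) :
    link γ η s ∈ Set.Icc 0 1 := by
  -- By monotonicity, `s` is squeezed between a point left of `-γ` and a point right of `γ`, where
  -- the link is constant.
  have h₁ : link γ η (min s (-γ - 1)) = η := by
    rw [link, if_pos]
    linarith [min_le_right s (-γ - 1)]
  have h₂ : link γ η (max s (γ + 1)) = 1 - η := by
    have := le_max_right s (γ + 1)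
    rw [link, if_neg (by linarith), if_neg (by linarith)]
  have h₃ := link_monotone hγ hη (min_le_left s (-γ - 1))
  have h₄ := link_monotone hγ hη (le_max_left s (γ + 1))
  constructor <;> linarith

/-- The derivative of the surrogate loss with respect to the score `⟨w, x⟩`. -/
noncomputable def residual (γ η s y : ℝ) : ℝ := link γ η s - (y + 1) / 2

lemma continuous_residual {γ : ℝ} (η y : ℝ) (hγ : 0 < γ) :
    Continuous fun s => residual γ η s y :=
  (continuous_link η hγ).sub continuous_const

lemma hasDerivAt_integral_residual {γ : ℝ} (η y : ℝ) (hγ : 0 < γ) (s : ℝ) :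
    HasDerivAt (fun s => ∫ t in (0 : ℝ)..s, residual γ η t y) (residual γ η s y) s :=
  (continuous_residual η y hγ).integral_hasStrictDerivAt 0 s |>.hasDerivAt

lemma abs_residual_le_one {γ η y : ℝ} (hγ : 0 < γ) (hη₀ : 0 ≤ η) (hη : η < 1 / 2)
    (hy : y = 1 ∨ y = -1) (s : ℝ) : |residual γ η s y| ≤ 1 := by
  obtain ⟨h₁, h₂⟩ := link_mem_Icc hγ hη₀ hη s
  rw [abs_le, residual]
  rcases hy with rfl | rfl <;> constructor <;> linarith

lemma convexOn_glmLoss {d : ℕ} {γ η : ℝ} (hγ : 0 < γ) (hη : η < 1 / 2) (z : E (Fin d) × ℝ) :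
    ConvexOn ℝ Set.univ fun w => glmLoss γ η w z := by
  have hd : deriv (fun s => ∫ t in (0 : ℝ)..s, residual γ η t z.2) =
      fun s => residual γ η s z.2 :=
    funext fun s => (hasDerivAt_integral_residual η z.2 hγ s).deriv
  have hconv : ConvexOn ℝ Set.univ fun s => ∫ t in (0 : ℝ)..s, residual γ η t z.2 := by
    refine Monotone.convexOn_univ_of_deriv
      (fun s => (hasDerivAt_integral_residual η z.2 hγ s).differentiableAt) ?_
    rw [hd]
    intro s t hst
    have := link_monotone hγ hη hst
    simp only [residual]
    linarith
  have h := hconv.comp_linearMap (innerₗ (E (Fin d)) z.1)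
  rw [Set.preimage_univ] at h
  refine h.congr fun w _ => ?_
  simp [glmLoss, residual, real_inner_comm]

lemma hasGradientAt_integral_residual_inner {F : Type*} [NormedAddCommGroup F]
    [InnerProductSpace ℝ F] [CompleteSpace F] {γ : ℝ} (η y : ℝ) (hγ : 0 < γ) (c v : F) :
    HasGradientAt (fun v => ∫ t in (0 : ℝ)..(inner ℝ c v), residual γ η t y)
      (residual γ η (inner ℝ c v) y • c) v := by
  rw [hasGradientAt_iff_hasFDerivAt]
  refine ((hasDerivAt_integral_residual η y hγ (inner ℝ c v)).comp_hasFDerivAt v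
    (innerSL ℝ c).hasFDerivAt).congr_fderiv ?_
  ext u
  simp

lemma gradient_glmLoss {d : ℕ} {γ : ℝ} (η : ℝ) (hγ : 0 < γ) (w : E (Fin d))
    (z : E (Fin d) × ℝ) :
    gradient (fun v => glmLoss γ η v z) w = residual γ η (inner ℝ w z.1) z.2 • z.1 := by
  simpa [glmLoss, residual, real_inner_comm] using
    (hasGradientAt_integral_residual_inner η z.2 hγ z.1 w).gradient

/-- The adjoint `x ↦ (x, -x)` of `signedPart`. -/
def signedLift {d : ℕ} (x : E (Fin d)) : E (Fin d ⊕ Fin d) :=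
  WithLp.toLp 2 (Sum.elim (fun i => x i) fun i => -x i)

lemma inner_signedPart {d : ℕ} (v : E (Fin d ⊕ Fin d)) (x : E (Fin d)) :
    inner ℝ (signedPart v) x = inner ℝ (signedLift x) v := by
  simp only [PiLp.inner_apply, signedPart, signedLift, Fintype.sum_sum_type, RCLike.inner_apply,
    conj_trivial, Sum.elim_inl, Sum.elim_inr, ← Finset.sum_add_distrib]
  exact Finset.sum_congr rfl fun i _ => by ring

lemma gradient_glmLoss_signedPart {d : ℕ} {γ : ℝ} (η : ℝ) (hγ : 0 < γ) (v : E (Fin d ⊕ Fin d))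
    (z : E (Fin d) × ℝ) :
    gradient (fun v => glmLoss γ η (signedPart v) z) v =
      residual γ η (inner ℝ (signedPart v) z.1) z.2 • signedLift z.1 := by
  simpa [glmLoss, residual, inner_signedPart] using
    (hasGradientAt_integral_residual_inner η z.2 hγ (signedLift z.1) v).gradient

/-! ### The `ℓ_q` norms on `ℝ^ι` -/

section VecNorm

variable {ι : Type} [Fintype ι] {q : ℝ≥0∞}

/-- The identity map from Euclidean space to the `ℓ_q` space. -/
noncomputable def toPiLp (ι : Type) [Fintype ι] (q : ℝ≥0∞) [Fact (1 ≤ q)] :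
    E ι →L[ℝ] PiLp q fun _ : ι => ℝ :=
  ((PiLp.continuousLinearEquiv 2 ℝ fun _ : ι => ℝ).trans
    (PiLp.continuousLinearEquiv q ℝ fun _ : ι => ℝ).symm).toContinuousLinearMap

lemma vecNorm_eq_norm_toPiLp [Fact (1 ≤ q)] (w : E ι) : vecNorm q w = ‖toPiLp ι q w‖ := rfl

lemma vecNorm_nonneg [Fact (1 ≤ q)] (w : E ι) : 0 ≤ vecNorm q w := by
  rw [vecNorm_eq_norm_toPiLp]
  exact norm_nonneg _

@[simp] lemma vecNorm_zero [Fact (1 ≤ q)] : vecNorm q (0 : E ι) = 0 := by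
  simp [vecNorm_eq_norm_toPiLp]

lemma vecNorm_smul [Fact (1 ≤ q)] (c : ℝ) (w : E ι) : vecNorm q (c • w) = |c| * vecNorm q w := by
  simp [vecNorm_eq_norm_toPiLp, norm_smul]

lemma abs_vecNorm_sub_vecNorm_le [Fact (1 ≤ q)] (v w : E ι) :
    |vecNorm q v - vecNorm q w| ≤ vecNorm q (v - w) := by
  simp only [vecNorm_eq_norm_toPiLp, map_sub]
  exact abs_norm_sub_norm_le _ _

lemma vecNorm_sum_le [Fact (1 ≤ q)] {α : Type*} (s : Finset α) (f : α → E ι) :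
    vecNorm q (∑ k ∈ s, f k) ≤ ∑ k ∈ s, vecNorm q (f k) := by
  simp only [vecNorm_eq_norm_toPiLp, map_sum]
  exact norm_sum_le _ _

lemma vecNorm_average_le_one [Fact (1 ≤ q)] {T : ℕ} {f : ℕ → E ι}
    (hf : ∀ k, vecNorm q (f k) ≤ 1) :
    vecNorm q ((T : ℝ)⁻¹ • ∑ k ∈ Finset.range T, f k) ≤ 1 := by
  rw [vecNorm_smul, abs_of_nonneg (by positivity)]
  have h : vecNorm q (∑ k ∈ Finset.range T, f k) ≤ T := by
    refine (vecNorm_sum_le _ _).trans ((Finset.sum_le_sum fun k _ => hf k).trans ?_)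
    simp
  calc (T : ℝ)⁻¹ * vecNorm q (∑ k ∈ Finset.range T, f k) ≤ (T : ℝ)⁻¹ * T := by gcongr
    _ ≤ 1 := inv_mul_le_one

lemma continuous_vecNorm [Fact (1 ≤ q)] : Continuous (vecNorm q : E ι → ℝ) :=
  (toPiLp ι q).continuous.norm

lemma vecNorm_eq_zero [Fact (1 ≤ q)] {w : E ι} : vecNorm q w = 0 ↔ w = 0 := by
  rw [vecNorm_eq_norm_toPiLp, norm_eq_zero]
  constructor
  · intro h
    ext i
    exact congrArg (fun v : PiLp q fun _ : ι => ℝ => v i) h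
  · rintro rfl
    simp

lemma abs_apply_le_vecNorm [Fact (1 ≤ q)] (w : E ι) (i : ι) : |w i| ≤ vecNorm q w :=
  PiLp.norm_apply_le (toPiLp ι q w) i

lemma vecNorm_top_le_one_iff {w : E ι} : vecNorm ∞ w ≤ 1 ↔ ∀ i, |w i| ≤ 1 := by
  constructor
  · exact fun h i => (abs_apply_le_vecNorm w i).trans h
  · intro h
    rw [vecNorm, PiLp.norm_toLp, pi_norm_le_iff_of_nonneg zero_le_one]
    exact h

lemma vecNorm_one (w : E ι) : vecNorm 1 w = ∑ i, |w i| := by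
  simp [vecNorm, PiLp.norm_eq_of_L1]

lemma vecNorm_two (w : E ι) : vecNorm 2 w = ‖w‖ := rfl

lemma vecNorm_eq_sum (hq : 0 < q.toReal) (w : E ι) :
    vecNorm q w = (∑ i, |w i| ^ q.toReal) ^ (1 / q.toReal) := by
  simp [vecNorm, PiLp.norm_eq_sum hq]

lemma vecNorm_rpow (hq : 0 < q.toReal) (w : E ι) :
    vecNorm q w ^ q.toReal = ∑ i, |w i| ^ q.toReal := by
  rw [vecNorm_eq_sum hq, ← Real.rpow_mul (by positivity), one_div_mul_cancel hq.ne', Real.rpow_one]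

lemma inner_eq_sum (v w : E ι) : inner ℝ v w = ∑ i, v i * w i := by
  simp [PiLp.inner_apply, mul_comm]

/-- Finiteness of both exponents rules out the endpoint pairs, so both exceed `1`. -/
lemma toReal_holderConjugate {p q : ℝ≥0∞} (h : ENNReal.HolderConjugate p q) (hp : p ≠ ∞)
    (hq : q ≠ ∞) : p.toReal.HolderConjugate q.toReal := by
  have h' := ENNReal.HolderConjugate.inv_add_inv_eq_one p q
  have hp₁ : 1 < p := by
    refine lt_of_le_of_ne (ENNReal.HolderConjugate.one_le p q) ?_
    rintro rfl
    apply hq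
    simpa using h'
  have hp₀ : p ≠ 0 := (zero_lt_one.trans hp₁).ne'
  have hq₀ : q ≠ 0 := (zero_lt_one.trans_le (ENNReal.HolderConjugate.one_le q p)).ne'
  rw [Real.holderConjugate_iff]
  refine ⟨?_, ?_⟩
  · rw [← ENNReal.toReal_one]
    exact (ENNReal.toReal_lt_toReal ENNReal.one_ne_top hp).2 hp₁
  · rw [← ENNReal.toReal_inv, ← ENNReal.toReal_inv, ← ENNReal.toReal_add (by simpa) (by simpa), h']
    simp

lemma inner_le_vecNorm_one_mul_vecNorm_top (v w : E ι) :
    inner ℝ v w ≤ vecNorm 1 v * vecNorm ∞ w := by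
  rw [inner_eq_sum, vecNorm_one, Finset.sum_mul]
  refine Finset.sum_le_sum fun i _ => (le_abs_self _).trans ?_
  rw [abs_mul]
  gcongr
  exact abs_apply_le_vecNorm w i

/-- Hölder's inequality. -/
lemma inner_le_vecNorm_mul_vecNorm {p q : ℝ≥0∞} (h : ENNReal.HolderConjugate p q) (v w : E ι) :
    inner ℝ v w ≤ vecNorm q v * vecNorm p w := by
  have h' := ENNReal.HolderConjugate.inv_add_inv_eq_one p q
  by_cases hp : p = ∞
  · obtain rfl : q = 1 := by simpa [hp] using h'
    rw [hp]
    exact inner_le_vecNorm_one_mul_vecNorm_top v w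
  by_cases hq : q = ∞
  · obtain rfl : p = 1 := by simpa [hq] using h'
    rw [hq, real_inner_comm, mul_comm]
    exact inner_le_vecNorm_one_mul_vecNorm_top w v
  have hc := toReal_holderConjugate h hp hq
  rw [inner_eq_sum, vecNorm_eq_sum hc.pos, vecNorm_eq_sum hc.symm.pos]
  exact Real.inner_le_Lp_mul_Lq _ _ _ hc.symm

lemma abs_inner_le_vecNorm_mul_vecNorm {p q : ℝ≥0∞} (h : ENNReal.HolderConjugate p q)
    (v w : E ι) : |inner ℝ v w| ≤ vecNorm q v * vecNorm p w := by
  have : Fact (1 ≤ q) := ⟨ENNReal.HolderConjugate.one_le q p⟩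
  rw [abs_le']
  refine ⟨inner_le_vecNorm_mul_vecNorm h v w, ?_⟩
  have := inner_le_vecNorm_mul_vecNorm h ((-1 : ℝ) • v) w
  rw [vecNorm_smul] at this
  simpa using this

end VecNorm

/-! ### Signed powers -/

/-- The signed power `sign t * |t| ^ r`. -/
noncomputable def signedPow (r t : ℝ) : ℝ := |t| ^ (r - 1) * t

lemma signedPow_of_nonneg {r t : ℝ} (hr : 0 < r) (ht : 0 ≤ t) : signedPow r t = t ^ r := by
  rcases ht.eq_or_lt with rfl | ht
  · simp [signedPow, Real.zero_rpow hr.ne']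
  · rw [signedPow, abs_of_pos ht, Real.rpow_sub_one ht.ne', div_mul_cancel₀ _ ht.ne']

lemma signedPow_neg (r t : ℝ) : signedPow r (-t) = -signedPow r t := by
  simp [signedPow]

@[simp] lemma signedPow_zero (r : ℝ) : signedPow r 0 = 0 := by simp [signedPow]

lemma abs_signedPow {r : ℝ} (hr : 0 < r) (t : ℝ) : |signedPow r t| = |t| ^ r := by
  rw [← signedPow_of_nonneg hr (abs_nonneg t), signedPow, signedPow, abs_mul, abs_abs,
    abs_of_nonneg (by positivity)]

lemma signedPow_mul_self {r : ℝ} (hr : 0 < r) (t : ℝ) : signedPow r t * t = |t| ^ (r + 1) := by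
  rw [Real.rpow_add_one' (abs_nonneg t) (by linarith), ← signedPow_of_nonneg hr (abs_nonneg t),
    signedPow, signedPow, abs_abs, mul_assoc, mul_assoc, abs_mul_abs_self]

lemma signedPow_signedPow {r r' : ℝ} (hr : 0 < r) (h : r * r' = 1) (t : ℝ) :
    signedPow r' (signedPow r t) = t := by
  have hr' : 0 < r' := by
    by_contra! hc
    nlinarith
  have key : ∀ t : ℝ, 0 ≤ t → signedPow r' (signedPow r t) = t := by
    intro t ht
    rw [signedPow_of_nonneg hr ht, signedPow_of_nonneg hr' (by positivity), ← Real.rpow_mul ht, h,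
      Real.rpow_one]
  rcases le_total 0 t with ht | ht
  · exact key t ht
  · have := key (-t) (by linarith)
    rw [signedPow_neg, signedPow_neg] at this
    linarith

/-- The factor `|t| ^ (r - 1)` is singular at `0` for `r < 1`; splitting into positive and negative
parts leaves only powers with exponent `r > 0`. -/
lemma continuous_signedPow {r : ℝ} (hr : 0 < r) : Continuous (signedPow r) := by
  have h : signedPow r = fun t => max t 0 ^ r - max (-t) 0 ^ r := by
    ext t
    rcases le_total 0 t with ht | ht
    · rw [max_eq_left ht, max_eq_right (by linarith), Real.zero_rpow hr.ne', sub_zero,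
        signedPow_of_nonneg hr ht]
    · rw [max_eq_right ht, max_eq_left (by linarith), Real.zero_rpow hr.ne', zero_sub,
        ← signedPow_of_nonneg hr (by linarith), signedPow_neg, neg_neg]
  rw [h]
  have hc : ∀ f : ℝ → ℝ, Continuous f → Continuous fun t => max (f t) 0 ^ r := fun f hf =>
    (hf.max continuous_const).rpow_const fun _ => Or.inr hr.le
  exact (hc _ continuous_id).sub (hc _ continuous_neg)

/-- For `r ≤ 1` this is subadditivity of the power; for `r ≥ 1` it is the mean value inequality, the
derivative being at most `r` on `[0, 1]`. The factor `1 + r` serves both cases. -/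
lemma rpow_sub_rpow_le {r a b : ℝ} (hr : 0 < r) (hb : 0 ≤ b) (hba : b ≤ a) (ha : a ≤ 1) :
    a ^ r - b ^ r ≤ (1 + r) * (a - b) ^ min 1 r := by
  have hab : 0 ≤ a - b := by linarith
  rcases le_total r 1 with h | h
  · rw [min_eq_right h]
    have := Real.rpow_add_le_add_rpow hab hb hr.le h
    rw [sub_add_cancel] at this
    nlinarith [Real.rpow_nonneg hab r]
  · rw [min_eq_left h, Real.rpow_one]
    have hd : ∀ x ∈ Set.Icc (0 : ℝ) 1,
        HasDerivWithinAt (fun x : ℝ => x ^ r) (r * x ^ (r - 1)) (Set.Icc 0 1) x := fun x _ =>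
      (Real.hasDerivAt_rpow_const (Or.inr h)).hasDerivWithinAt
    have := (convex_Icc (0 : ℝ) 1).norm_image_sub_le_of_norm_hasDerivWithin_le hd (C := r)
      (fun x hx => by
        rw [norm_mul, Real.norm_of_nonneg hr.le, Real.norm_of_nonneg (by have := hx.1; positivity)]
        exact mul_le_of_le_one_right hr.le (Real.rpow_le_one hx.1 hx.2 (by linarith)))
      ⟨hb, hba.trans ha⟩ ⟨hb.trans hba, ha⟩
    rw [Real.norm_eq_abs, Real.norm_of_nonneg hab] at this
    nlinarith [le_abs_self (a ^ r - b ^ r)]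

/-- Signed powers are Hölder continuous on `[-1, 1]`. -/
lemma abs_signedPow_sub_le {r a b : ℝ} (hr : 0 < r) (ha : |a| ≤ 1) (hb : |b| ≤ 1) :
    |signedPow r a - signedPow r b| ≤ 2 * (1 + r) * |a - b| ^ min 1 r := by
  have key : ∀ a b : ℝ, b ≤ a → |a| ≤ 1 → |b| ≤ 1 →
      |signedPow r a - signedPow r b| ≤ 2 * (1 + r) * |a - b| ^ min 1 r := by
    intro a b hba ha hb
    have hmin : 0 < min 1 r := lt_min one_pos hr
    obtain ⟨ha₁, ha₂⟩ := abs_le.1 ha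
    obtain ⟨hb₁, hb₂⟩ := abs_le.1 hb
    have hab : 0 ≤ a - b := by linarith
    have hnn : 0 ≤ (1 + r) * (a - b) ^ min 1 r := by positivity
    rw [abs_of_nonneg hab, mul_assoc]
    rcases le_total 0 b with h₁ | h₁
    · rw [signedPow_of_nonneg hr h₁, signedPow_of_nonneg hr (h₁.trans hba), abs_of_nonneg]
      · linarith [rpow_sub_rpow_le hr h₁ hba ha₂]
      · exact sub_nonneg.2 (Real.rpow_le_rpow h₁ hba hr.le)
    rcases le_total 0 a with h₂ | h₂
    -- Opposite signs: each power is bounded separately by `a - b`, which costs the factor `2` in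
    -- the constant.
    · refine (abs_sub _ _).trans ?_
      rw [abs_signedPow hr, abs_signedPow hr]
      have hs : ∀ c : ℝ, 0 ≤ c → c ≤ 1 → c ≤ a - b → c ^ r ≤ (1 + r) * (a - b) ^ min 1 r := by
        intro c hc hc₁ hcab
        have h := rpow_sub_rpow_le hr le_rfl hc hc₁
        rw [Real.zero_rpow hr.ne', sub_zero, sub_zero] at h
        refine h.trans ?_
        gcongr
      have hs₁ := hs |a| (abs_nonneg a) ha (by rw [abs_of_nonneg h₂]; linarith)
      have hs₂ := hs |b| (abs_nonneg b) hb (by rw [abs_of_nonpos h₁]; linarith)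
      linarith
    · have ha' : 0 ≤ -a := by linarith
      have hneg : signedPow r a - signedPow r b = (-b) ^ r - (-a) ^ r := by
        rw [← signedPow_of_nonneg hr ha', ← signedPow_of_nonneg hr (by linarith : 0 ≤ -b),
          signedPow_neg, signedPow_neg]
        ring
      rw [hneg, abs_of_nonneg]
      · have := rpow_sub_rpow_le hr ha' (by linarith : -a ≤ -b) (by linarith)
        rw [show -b - -a = a - b by ring] at this
        linarith
      · exact sub_nonneg.2 (Real.rpow_le_rpow ha' (by linarith) hr.le)
  rcases le_total b a with h | h
  · exact key a b h ha hb
  · rw [abs_sub_comm, abs_sub_comm a b]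
    exact key b a h hb ha

/-! ### The gradient of `‖w‖_q² / 2` -/

section DualityMap

variable {ι : Type} [Fintype ι] {p q : ℝ≥0∞}

/-- The gradient of `‖w‖_q² / 2`, the duality map of the `ℓ_q` norm. -/
noncomputable def dualityMap (q : ℝ≥0∞) (w : E ι) : E ι :=
  WithLp.toLp 2 fun i => vecNorm q w * signedPow (q.toReal - 1) (w i / vecNorm q w)

lemma dualityMap_apply (w : E ι) (i : ι) :
    dualityMap q w i = vecNorm q w * signedPow (q.toReal - 1) (w i / vecNorm q w) := rfl

lemma measurable_dualityMap [Fact (1 ≤ q)] (hq : 1 < q.toReal) :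
    Measurable (dualityMap q : E ι → E ι) := by
  refine (WithLp.measurable_toLp 2 _).comp (measurable_pi_lambda _ fun i => ?_)
  have hN : Measurable (vecNorm q : E ι → ℝ) := continuous_vecNorm.measurable
  have hi : Measurable fun w : E ι => w i := by fun_prop
  exact hN.mul ((continuous_signedPow (sub_pos.2 hq)).measurable.comp (hi.div hN))

@[simp] lemma dualityMap_zero [Fact (1 ≤ q)] : dualityMap q (0 : E ι) = 0 := by
  ext i
  simp [dualityMap_apply]

lemma dualityMap_smul [Fact (1 ≤ q)] {c : ℝ} (hc : 0 ≤ c) (w : E ι) :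
    dualityMap q (c • w) = c • dualityMap q w := by
  ext i
  rcases hc.eq_or_lt with rfl | hc'
  · simp
  · simp only [dualityMap_apply, vecNorm_smul, abs_of_nonneg hc, PiLp.smul_apply, smul_eq_mul]
    rw [mul_div_mul_left _ _ hc'.ne', mul_assoc]

lemma sum_abs_div_vecNorm_rpow [Fact (1 ≤ q)] (hq : 0 < q.toReal) {w : E ι} (hw : w ≠ 0) :
    ∑ i, |w i / vecNorm q w| ^ q.toReal = 1 := by
  have hN : 0 < vecNorm q w := (vecNorm_nonneg w).lt_of_ne' (mt vecNorm_eq_zero.1 hw)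
  have h : ∀ i, |w i / vecNorm q w| ^ q.toReal =
      |w i| ^ q.toReal / vecNorm q w ^ q.toReal := fun i => by
    rw [abs_div, abs_of_pos hN, Real.div_rpow (abs_nonneg _) hN.le]
  rw [Finset.sum_congr rfl fun i _ => h i, ← Finset.sum_div, ← vecNorm_rpow hq, div_self]
  positivity

lemma inner_dualityMap_self [Fact (1 ≤ q)] (hq : 1 < q.toReal) (w : E ι) :
    inner ℝ (dualityMap q w) w = vecNorm q w ^ 2 := by
  rcases eq_or_ne w 0 with rfl | hw
  · simp
  have hN : vecNorm q w ≠ 0 := mt vecNorm_eq_zero.1 hw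
  rw [inner_eq_sum, ← mul_one (vecNorm q w ^ 2),
    ← sum_abs_div_vecNorm_rpow (zero_lt_one.trans hq) hw, Finset.mul_sum]
  refine Finset.sum_congr rfl fun i _ => ?_
  have h := signedPow_mul_self (sub_pos.2 hq) (w i / vecNorm q w)
  rw [sub_add_cancel] at h
  rw [← h, dualityMap_apply]
  field_simp

lemma vecNorm_dualityMap [Fact (1 ≤ p)] [Fact (1 ≤ q)] (h : p.toReal.HolderConjugate q.toReal)
    (w : E ι) : vecNorm p (dualityMap q w) = vecNorm q w := by
  rcases eq_or_ne w 0 with rfl | hw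
  · simp
  have hq : 0 < q.toReal - 1 := h.symm.sub_one_pos
  rw [vecNorm_eq_sum h.pos]
  have key : ∑ i, |dualityMap q w i| ^ p.toReal = vecNorm q w ^ p.toReal := by
    rw [← mul_one (vecNorm q w ^ p.toReal), ← sum_abs_div_vecNorm_rpow h.symm.pos hw,
      Finset.mul_sum]
    refine Finset.sum_congr rfl fun i _ => ?_
    rw [dualityMap_apply, abs_mul, abs_of_nonneg (vecNorm_nonneg w), abs_signedPow hq,
      Real.mul_rpow (vecNorm_nonneg w) (by positivity), ← Real.rpow_mul (abs_nonneg _),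
      h.symm.sub_one_mul_conj]
  rw [key, ← Real.rpow_mul (vecNorm_nonneg w), mul_one_div_cancel h.ne_zero, Real.rpow_one]

lemma dualityMap_dualityMap [Fact (1 ≤ p)] [Fact (1 ≤ q)]
    (h : p.toReal.HolderConjugate q.toReal) (w : E ι) :
    dualityMap p (dualityMap q w) = w := by
  rcases eq_or_ne w 0 with rfl | hw
  · simp
  have hN : vecNorm q w ≠ 0 := mt vecNorm_eq_zero.1 hw
  ext i
  rw [dualityMap_apply, vecNorm_dualityMap h, dualityMap_apply, mul_div_cancel_left₀ _ hN,
    signedPow_signedPow h.symm.sub_one_pos, mul_div_cancel₀ _ hN]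
  have := h.mul_eq_add
  linarith

/-- The duality map of the `ℓ_q` norm is Hölder continuous near the unit ball, with exponent
`min 1 (q - 1)`. -/
lemma abs_dualityMap_sub_le [Fact (1 ≤ q)] (hq : 1 < q.toReal) {v w : E ι} {a : ℝ}
    (hv : vecNorm q v ≤ 1) (ha : a ≤ 1) (hvw : vecNorm q (v - w) ≤ a) (i : ι) :
    |dualityMap q v i - dualityMap q w i| ≤ (1 + 4 * q.toReal) * a ^ min 1 (q.toReal - 1) := by
  set r := q.toReal - 1 with hr
  set t := min 1 r
  set N := vecNorm q v with hN
  set N' := vecNorm q w with hN'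
  set Δ := vecNorm q (v - w) with hΔ
  have hr₀ : 0 < r := sub_pos.2 hq
  have ht₀ : 0 < t := lt_min one_pos hr₀
  have ht₁ : t ≤ 1 := min_le_left _ _
  have hΔ₀ : 0 ≤ Δ := vecNorm_nonneg _
  have ha₀ : 0 ≤ a := hΔ₀.trans hvw
  have hN₀ : 0 ≤ N := vecNorm_nonneg _
  have hN₀' : 0 ≤ N' := vecNorm_nonneg _
  have hΔt : Δ ≤ a ^ t := by
    calc Δ ≤ a ^ (1 : ℝ) := by simpa using hvw
      _ ≤ a ^ t := Real.rpow_le_rpow_of_exponent_ge' ha₀ ha ht₀.le ht₁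
  have hNN : |N - N'| ≤ Δ := abs_vecNorm_sub_vecNorm_le v w
  have hquot : ∀ (x : E ι), |x i / vecNorm q x| ≤ 1 := fun x => by
    rw [abs_div, abs_of_nonneg (vecNorm_nonneg x)]
    exact div_le_one_of_le₀ (abs_apply_le_vecNorm x i) (vecNorm_nonneg x)
  -- This also holds for norm zero, since then every coordinate vanishes.
  have hmul : ∀ (x : E ι), x i = x i / vecNorm q x * vecNorm q x := fun x => by
    rcases eq_or_ne (vecNorm q x) 0 with h | h
    · have := abs_apply_le_vecNorm (q := q) x i
      rw [h] at this ⊢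
      simpa using this
    · rw [div_mul_cancel₀ _ h]
  set c := v i / N with hc
  set b := w i / N' with hb
  have hc₁ : |c| ≤ 1 := hquot v
  have hb₁ : |b| ≤ 1 := hquot w
  have hσb : |signedPow r b| ≤ 1 := by
    rw [abs_signedPow hr₀]
    exact Real.rpow_le_one (abs_nonneg _) hb₁ hr₀.le
  -- Normalization `v ↦ v / ‖v‖` is not Lipschitz near the origin, but the factor `N` compensates.
  have hdiff : N * |c - b| ≤ 2 * Δ := by
    have h₁ : N * (c - b) = (v - w) i + b * (N' - N) := by
      rw [PiLp.sub_apply, hmul v, hmul w]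
      ring
    rw [show N * |c - b| = |N * (c - b)| by rw [abs_mul, abs_of_nonneg hN₀], h₁]
    refine (abs_add_le _ _).trans ?_
    rw [abs_mul, abs_sub_comm N']
    have := abs_apply_le_vecNorm (q := q) (v - w) i
    nlinarith [abs_nonneg b, abs_nonneg (N - N')]
  -- Since `N ≤ 1` and `t ≤ 1`, `N ≤ N ^ t`, so the factor `N` can be moved inside the power and
  -- `hdiff` applies.
  have hhold : N * |c - b| ^ t ≤ 2 * a ^ t := by
    calc N * |c - b| ^ t ≤ N ^ t * |c - b| ^ t := by
          gcongr
          calc N = N ^ (1 : ℝ) := (Real.rpow_one N).symm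
            _ ≤ N ^ t := Real.rpow_le_rpow_of_exponent_ge' hN₀ hv ht₀.le ht₁
      _ = (N * |c - b|) ^ t := (Real.mul_rpow hN₀ (abs_nonneg _)).symm
      _ ≤ (2 * a) ^ t := by
          apply Real.rpow_le_rpow (by positivity) (by linarith) ht₀.le
      _ = 2 ^ t * a ^ t := Real.mul_rpow zero_le_two ha₀
      _ ≤ 2 * a ^ t := by
          gcongr
          calc (2 : ℝ) ^ t ≤ 2 ^ (1 : ℝ) := Real.rpow_le_rpow_of_exponent_le one_le_two ht₁
            _ = 2 := Real.rpow_one 2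
  have hsplit : dualityMap q v i - dualityMap q w i =
      (N - N') * signedPow r b + N * (signedPow r c - signedPow r b) := by
    rw [dualityMap_apply, dualityMap_apply]
    ring
  rw [hsplit]
  refine (abs_add_le _ _).trans ?_
  rw [abs_mul, abs_mul, abs_of_nonneg hN₀]
  have h₁ : |N - N'| * |signedPow r b| ≤ a ^ t :=
    (mul_le_of_le_one_right (abs_nonneg _) hσb).trans (hNN.trans hΔt)
  have h₂ : N * |signedPow r c - signedPow r b| ≤ 4 * (1 + r) * a ^ t := by
    calc N * |signedPow r c - signedPow r b| ≤ N * (2 * (1 + r) * |c - b| ^ t) := by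
          gcongr
          exact abs_signedPow_sub_le hr₀ hc₁ hb₁
      _ = 2 * (1 + r) * (N * |c - b| ^ t) := by ring
      _ ≤ 2 * (1 + r) * (2 * a ^ t) := by gcongr
      _ = 4 * (1 + r) * a ^ t := by ring
  have h₃ : q.toReal = 1 + r := by rw [hr]; ring
  rw [h₃]
  linarith

/-- The chain rule used away from the origin needs a nonzero power sum; here it is enough that the
potential is `O(‖v‖ ^ 2)`. -/
lemma hasGradientAt_lpPotential_zero [Fact (1 ≤ q)] :
    HasGradientAt (lpPotential q : E ι → ℝ) 0 0 := by
  rw [hasGradientAt_iff_isLittleO]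
  have hO : (fun v : E ι => lpPotential q v) =O[nhds 0] fun v => ‖v‖ ^ 2 := by
    refine Asymptotics.IsBigO.of_bound (‖toPiLp ι q‖ ^ 2 / 2) (Filter.Eventually.of_forall
      fun v => ?_)
    have h := (toPiLp ι q).le_opNorm v
    rw [lpPotential, vecNorm_eq_norm_toPiLp, Real.norm_of_nonneg (by positivity),
      Real.norm_of_nonneg (by positivity)]
    calc ‖toPiLp ι q v‖ ^ 2 / 2 ≤ (‖toPiLp ι q‖ * ‖v‖) ^ 2 / 2 := by gcongr
      _ = _ := by ring
  simpa [lpPotential] using hO.trans_isLittleO (Asymptotics.isLittleO_norm_pow_id one_lt_two)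

lemma hasGradientAt_lpPotential [Fact (1 ≤ q)] (hq : 1 < q.toReal) (w : E ι) :
    HasGradientAt (lpPotential q) (dualityMap q w) w := by
  rcases eq_or_ne w 0 with rfl | hw
  · rw [dualityMap_zero]
    exact hasGradientAt_lpPotential_zero
  set r := q.toReal with hr
  have hr₀ : 0 < r := zero_lt_one.trans hq
  have hN : 0 < vecNorm q w := (vecNorm_nonneg w).lt_of_ne' (mt vecNorm_eq_zero.1 hw)
  have hψ : (lpPotential q : E ι → ℝ) = fun v => (∑ i, |v i| ^ r) ^ (2 / r) / 2 := by
    ext v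
    rw [lpPotential, vecNorm_eq_sum hr₀, ← Real.rpow_natCast, ← Real.rpow_mul (by positivity)]
    congr 2
    push_cast
    ring
  have hS : 0 < ∑ i, |w i| ^ r := by
    rw [← vecNorm_rpow hr₀]
    positivity
  have hsum : HasFDerivAt (fun v : E ι => ∑ i, |v i| ^ r)
      (∑ i, (r * |w i| ^ (r - 2) * w i) • (EuclideanSpace.proj i : E ι →L[ℝ] ℝ)) w := by
    refine HasFDerivAt.fun_sum fun i _ => ?_
    exact (hasDerivAt_abs_rpow (w i) hq).comp_hasFDerivAt w
      (EuclideanSpace.proj i : E ι →L[ℝ] ℝ).hasFDerivAt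
  rw [hasGradientAt_iff_hasFDerivAt, hψ]
  have hd := ((hsum.rpow_const (p := 2 / r) (Or.inl hS.ne')).mul_const (2 : ℝ)⁻¹)
  simp only [← div_eq_mul_inv] at hd
  refine hd.congr_fderiv ?_
  ext u
  have hcoef : ∀ i, dualityMap q w i =
      (2 : ℝ)⁻¹ * (2 / r * (∑ i, |w i| ^ r) ^ (2 / r - 1)) * (r * |w i| ^ (r - 2) * w i) := by
    intro i
    rw [dualityMap_apply, ← hr, signedPow, ← vecNorm_rpow hr₀, ← hr,
      ← Real.rpow_mul hN.le, abs_div, abs_of_pos hN, Real.div_rpow (abs_nonneg _) hN.le,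
      show r * (2 / r - 1) = -(r - 1 - 1) by field_simp; ring, Real.rpow_neg hN.le,
      show r - 2 = r - 1 - 1 by ring]
    field_simp
  simp only [smul_apply, sum_apply, smul_eq_mul,
    InnerProductSpace.toDual_apply_apply, inner_eq_sum, hcoef, Finset.mul_sum]
  refine Finset.sum_congr rfl fun i _ => ?_
  simp only [PiLp.proj_apply]
  ring

lemma gradient_lpPotential [Fact (1 ≤ q)] (hq : 1 < q.toReal) :
    gradient (lpPotential q : E ι → ℝ) = dualityMap q :=
  gradient_eq (hasGradientAt_lpPotential hq)

end DualityMap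

/-! ### Bregman projections and the regret of a mirror descent step -/

section Bregman

variable {F : Type} [NormedAddCommGroup F] [InnerProductSpace ℝ F] [CompleteSpace F]
  {ψ : F → ℝ} {dom K : Set F}

/-- The projection is an arbitrary choice among minimizers. The Pythagorean inequality `hpyth` makes
`w` a minimizer and forces any other minimizer to have divergence at most `0` from it, so `heq`
leaves no choice. -/
lemma bregmanProj_eq {w y : F} (hw : w ∈ K ∩ dom)
    (hpyth : ∀ u ∈ K ∩ dom, bregman ψ u w + bregman ψ w y ≤ bregman ψ u y)
    (hnonneg : ∀ u ∈ K ∩ dom, 0 ≤ bregman ψ u w)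
    (heq : ∀ u ∈ K ∩ dom, bregman ψ u w ≤ 0 → u = w) :
    bregmanProj ψ dom K y = w := by
  have hmin : w ∈ K ∩ dom ∧ ∀ v ∈ K ∩ dom, bregman ψ w y ≤ bregman ψ v y :=
    ⟨hw, fun v hv => by linarith [hpyth v hv, hnonneg v hv]⟩
  obtain ⟨h₁, h₂⟩ := Classical.epsilon_spec (p := fun w => w ∈ K ∩ dom ∧
    ∀ v ∈ K ∩ dom, bregman ψ w y ≤ bregman ψ v y) ⟨w, hmin⟩
  have h := heq _ h₁ (by linarith [hpyth _ h₁, h₂ w hw])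
  exact h

lemma invFunOn_eq_of_injOn {α β : Type*} [Nonempty α] {f : α → β} {s : Set α}
    (hf : Set.InjOn f s) {y : α} (hy : y ∈ s) {b : β} (hb : f y = b) :
    Function.invFunOn f s b = y := by
  rw [← hb]
  exact hf.leftInvOn_invFunOn hy

/-- If a point minimizes a Bregman divergence, then the gradients at both arguments agree. -/
lemma gradient_eq_of_bregman_minimal {u w : F} (hu : DifferentiableAt ℝ ψ u)
    (hnonneg : ∀ v, 0 ≤ bregman ψ v w) (hzero : bregman ψ u w ≤ 0) :
    gradient ψ u = gradient ψ w := by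
  have hd : HasFDerivAt (fun v => bregman ψ v w)
      (InnerProductSpace.toDual ℝ F (gradient ψ u) - innerSL ℝ (gradient ψ w)) u := by
    have h₁ := hu.hasGradientAt.hasFDerivAt.sub_const (ψ w)
    have h₂ : HasFDerivAt (fun v => inner ℝ (gradient ψ w) (v - w))
        (innerSL ℝ (gradient ψ w)) u := by
      exact ((innerSL ℝ (gradient ψ w)).hasFDerivAt.comp u
        ((hasFDerivAt_id u).sub_const w)).congr_fderiv (ContinuousLinearMap.comp_id _)
    exact h₁.sub h₂
  have hmin : IsLocalMin (fun v => bregman ψ v w) u :=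
    Filter.Eventually.of_forall fun v => hzero.trans (hnonneg v)
  have h := hmin.hasFDerivAt_eq_zero hd
  refine ext_inner_right ℝ fun v => ?_
  have := congrArg (fun L : F →L[ℝ] ℝ => L v) h
  simpa [sub_eq_zero] using this

/-- The regret of one mirror descent step from `w`, through the unprojected point `y`, to `w'`. -/
lemma mirror_step_regret {a : ℝ} {u w y w' g : F}
    (hy : gradient ψ y = gradient ψ w - a • g) (hpyth : bregman ψ u w' ≤ bregman ψ u y)
    (hnonneg : 0 ≤ bregman ψ y w) :
    a * inner ℝ g (w - u) ≤ bregman ψ u w - bregman ψ u w' + a * inner ℝ g (w - y) := by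
  -- Three-point identity for the divergence; the term `-D(y, w)` is simply discarded afterwards.
  have h : a * inner ℝ g (w - u) =
      bregman ψ u w - bregman ψ u y + a * inner ℝ g (w - y) - bregman ψ y w := by
    simp only [bregman, hy, inner_sub_left, inner_sub_right, inner_smul_left, conj_trivial]
    ring
  linarith

lemma sum_mirror_step_regret {a b : ℝ} {u : F} {w g : ℕ → F} (T : ℕ)
    (hstep : ∀ k, a * inner ℝ (g k) (w k - u) ≤
      bregman ψ u (w k) - bregman ψ u (w (k + 1)) + b)
    (hnonneg : 0 ≤ bregman ψ u (w T)) :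
    ∑ k ∈ Finset.range T, a * inner ℝ (g k) (w k - u) ≤ bregman ψ u (w 0) + T * b := by
  have h := Finset.sum_le_sum fun k (_ : k ∈ Finset.range T) => hstep k
  rw [Finset.sum_add_distrib, Finset.sum_range_sub' (fun k => bregman ψ u (w k))] at h
  simp only [Finset.sum_const, Finset.card_range, nsmul_eq_mul] at h
  linarith

end Bregman

/-! ### Mirror descent with the potential `‖w‖_q² / 2` -/

section LpStep

variable {ι : Type} [Fintype ι] {p q : ℝ≥0∞}

lemma bregman_lpPotential [Fact (1 ≤ q)] (hq : 1 < q.toReal) (u w : E ι) :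
    bregman (lpPotential q) u w =
      (vecNorm q u ^ 2 + vecNorm q w ^ 2) / 2 - inner ℝ (dualityMap q w) u := by
  rw [bregman, gradient_lpPotential hq, inner_sub_right, inner_dualityMap_self hq, lpPotential,
    lpPotential]
  ring

lemma inner_dualityMap_le (h : ENNReal.HolderConjugate p q) (hp : p ≠ ∞) (hq : q ≠ ∞)
    (u w : E ι) : inner ℝ (dualityMap q w) u ≤ vecNorm q w * vecNorm q u := by
  have : Fact (1 ≤ p) := ⟨ENNReal.HolderConjugate.one_le p q⟩
  have : Fact (1 ≤ q) := ⟨ENNReal.HolderConjugate.one_le q p⟩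
  have hle := inner_le_vecNorm_mul_vecNorm h u (dualityMap q w)
  rw [vecNorm_dualityMap (toReal_holderConjugate h hp hq)] at hle
  rw [real_inner_comm, mul_comm]
  exact hle

lemma bregman_lpPotential_nonneg (h : ENNReal.HolderConjugate p q) (hp : p ≠ ∞) (hq : q ≠ ∞)
    (u w : E ι) : 0 ≤ bregman (lpPotential q) u w := by
  have : Fact (1 ≤ q) := ⟨ENNReal.HolderConjugate.one_le q p⟩
  rw [bregman_lpPotential (toReal_holderConjugate h hp hq).symm.lt]
  nlinarith [inner_dualityMap_le h hp hq u w, sq_nonneg (vecNorm q u - vecNorm q w)]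

lemma dualityMap_injective (h : ENNReal.HolderConjugate p q) (hp : p ≠ ∞) (hq : q ≠ ∞) :
    Function.Injective (dualityMap q : E ι → E ι) := by
  have : Fact (1 ≤ p) := ⟨ENNReal.HolderConjugate.one_le p q⟩
  have : Fact (1 ≤ q) := ⟨ENNReal.HolderConjugate.one_le q p⟩
  exact Function.LeftInverse.injective (dualityMap_dualityMap (toReal_holderConjugate h hp hq))

/-- This stands in for strict convexity: a zero of the nonnegative divergence is a minimum in its
first argument, so the gradients agree, and the duality map is injective. -/
lemma eq_of_bregman_lpPotential_le_zero (h : ENNReal.HolderConjugate p q) (hp : p ≠ ∞)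
    (hq : q ≠ ∞) {u w : E ι} (huw : bregman (lpPotential q) u w ≤ 0) : u = w := by
  have : Fact (1 ≤ q) := ⟨ENNReal.HolderConjugate.one_le q p⟩
  have hq₁ := (toReal_holderConjugate h hp hq).symm.lt
  have hg := gradient_eq_of_bregman_minimal (hasGradientAt_lpPotential hq₁ u).differentiableAt
    (fun v => bregman_lpPotential_nonneg h hp hq v w) huw
  rw [gradient_lpPotential hq₁] at hg
  exact dualityMap_injective h hp hq hg

/-- The radial projection onto the `ℓ_q` unit ball. -/
noncomputable def radialProj (q : ℝ≥0∞) (y : E ι) : E ι := (max 1 (vecNorm q y))⁻¹ • y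

lemma vecNorm_radialProj_le_one [Fact (1 ≤ q)] (y : E ι) : vecNorm q (radialProj q y) ≤ 1 := by
  rw [radialProj, vecNorm_smul, abs_of_nonneg (by positivity), inv_mul_eq_div]
  exact div_le_one_of_le₀ (le_max_right _ _) (by positivity)

lemma measurable_radialProj [Fact (1 ≤ q)] : Measurable (radialProj q : E ι → E ι) := by
  have h : Measurable (vecNorm q : E ι → ℝ) := continuous_vecNorm.measurable
  exact (measurable_const.max h).inv.smul measurable_id

/-- With `y = N • w`, homogeneity of the duality map `J` turns the defect into `(N - 1) (‖w‖ ^ 2 -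
⟨J w, u⟩)`. Either `N = 1`, or `‖w‖ = 1` and Hölder's inequality gives the sign. -/
lemma bregman_radialProj_add_le (h : ENNReal.HolderConjugate p q) (hp : p ≠ ∞) (hq : q ≠ ∞)
    {u : E ι} (hu : vecNorm q u ≤ 1) (y : E ι) :
    bregman (lpPotential q) u (radialProj q y) + bregman (lpPotential q) (radialProj q y) y ≤
      bregman (lpPotential q) u y := by
  have : Fact (1 ≤ q) := ⟨ENNReal.HolderConjugate.one_le q p⟩
  have hq₁ := (toReal_holderConjugate h hp hq).symm.lt
  set N := max 1 (vecNorm q y) with hN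
  set w := radialProj q y with hw
  have hN₁ : 1 ≤ N := le_max_left _ _
  have hN₀ : 0 < N := zero_lt_one.trans_le hN₁
  have hy : y = N • w := by rw [hw, radialProj, smul_inv_smul₀ hN₀.ne']
  have hin : inner ℝ (dualityMap q w) u ≤ vecNorm q w :=
    (inner_dualityMap_le h hp hq u w).trans (mul_le_of_le_one_right (vecNorm_nonneg w) hu)
  have hcase : (N - 1) * vecNorm q w = (N - 1) * vecNorm q w ^ 2 := by
    rcases le_total (vecNorm q y) 1 with hy₁ | hy₁
    · rw [hN, max_eq_left hy₁]
      ring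
    · have hyN : vecNorm q y = N := by rw [hN, max_eq_right hy₁]
      have hwn : vecNorm q w = 1 := by
        rw [hw, radialProj, vecNorm_smul, ← hN, hyN, abs_of_pos (inv_pos.2 hN₀),
          inv_mul_cancel₀ hN₀.ne']
      rw [hwn]
      ring
  simp only [bregman_lpPotential hq₁]
  rw [hy, dualityMap_smul hN₀.le, vecNorm_smul, abs_of_pos hN₀, inner_smul_left, inner_smul_left,
    inner_dualityMap_self hq₁, conj_trivial]
  nlinarith [mul_le_mul_of_nonneg_left hin (sub_nonneg.2 hN₁)]

lemma bregmanProj_lpPotential (h : ENNReal.HolderConjugate p q) (hp : p ≠ ∞) (hq : q ≠ ∞)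
    (y : E ι) :
    bregmanProj (lpPotential q) Set.univ (lpUnitBall q) y = radialProj q y := by
  have : Fact (1 ≤ q) := ⟨ENNReal.HolderConjugate.one_le q p⟩
  exact bregmanProj_eq ⟨vecNorm_radialProj_le_one y, trivial⟩
    (fun u hu => bregman_radialProj_add_le h hp hq hu.1 y)
    (fun u _ => bregman_lpPotential_nonneg h hp hq u _)
    fun u _ => eq_of_bregman_lpPotential_le_zero h hp hq

lemma invFunOn_gradient_lpPotential (h : ENNReal.HolderConjugate p q) (hp : p ≠ ∞) (hq : q ≠ ∞)
    (θ : E ι) :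
    Function.invFunOn (gradient (lpPotential q)) Set.univ θ = dualityMap p θ := by
  have : Fact (1 ≤ p) := ⟨ENNReal.HolderConjugate.one_le p q⟩
  have : Fact (1 ≤ q) := ⟨ENNReal.HolderConjugate.one_le q p⟩
  have hc := toReal_holderConjugate h hp hq
  refine invFunOn_eq_of_injOn ?_ (Set.mem_univ _) ?_
  · rw [gradient_lpPotential hc.symm.lt]
    exact (dualityMap_injective h hp hq).injOn
  · rw [gradient_lpPotential hc.symm.lt, dualityMap_dualityMap hc.symm]

lemma mirrorStep_lpPotential (h : ENNReal.HolderConjugate p q) (hp : p ≠ ∞) (hq : q ≠ ∞)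
    (a : ℝ) (w g : E ι) :
    mirrorStep (lpPotential q) Set.univ (lpUnitBall q) a w g =
      radialProj q (dualityMap p (dualityMap q w - a • g)) := by
  have : Fact (1 ≤ q) := ⟨ENNReal.HolderConjugate.one_le q p⟩
  rw [mirrorStep, bregmanProj_lpPotential h hp hq, invFunOn_gradient_lpPotential h hp hq,
    gradient_lpPotential (toReal_holderConjugate h hp hq).symm.lt]

lemma regret_mirrorStep_lpPotential (h : ENNReal.HolderConjugate p q) (hp : p ≠ ∞) (hq : q ≠ ∞)
    {a : ℝ} (ha₀ : 0 ≤ a) (ha : a ≤ 1) {u w g : E ι} (hu : vecNorm q u ≤ 1)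
    (hw : vecNorm q w ≤ 1) (hg : vecNorm p g ≤ 1) :
    a * inner ℝ g (w - u) ≤ bregman (lpPotential q) u w -
      bregman (lpPotential q) u (mirrorStep (lpPotential q) Set.univ (lpUnitBall q) a w g) +
      a * (Fintype.card ι * ((1 + 4 * p.toReal) * a ^ min 1 (p.toReal - 1))) := by
  have : Fact (1 ≤ p) := ⟨ENNReal.HolderConjugate.one_le p q⟩
  have : Fact (1 ≤ q) := ⟨ENNReal.HolderConjugate.one_le q p⟩
  have hc := toReal_holderConjugate h hp hq
  set y := dualityMap p (dualityMap q w - a • g) with hy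
  rw [mirrorStep_lpPotential h hp hq, ← hy]
  have hbound : inner ℝ g (w - y) ≤
      Fintype.card ι * ((1 + 4 * p.toReal) * a ^ min 1 (p.toReal - 1)) := by
    rw [inner_eq_sum, ← nsmul_eq_mul]
    refine Finset.sum_le_card_nsmul _ _ _ fun i _ => (le_abs_self _).trans ?_
    -- Hölder continuity is applied on the dual side, where `∇ψ(w)` has `ℓ_p` norm at most `1` and
    -- the step moves it by at most `a`.
    have hd := abs_dualityMap_sub_le hc.lt (v := dualityMap q w) (w := dualityMap q w - a • g)
      (by rwa [vecNorm_dualityMap hc]) ha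
      (by rw [sub_sub_cancel, vecNorm_smul, abs_of_nonneg ha₀]
          exact mul_le_of_le_one_right ha₀ hg) i
    rw [dualityMap_dualityMap hc, ← hy] at hd
    rw [abs_mul, PiLp.sub_apply]
    exact (mul_le_of_le_one_left (abs_nonneg _) ((abs_apply_le_vecNorm g i).trans hg)).trans hd
  refine (mirror_step_regret (y := y) (w' := radialProj q y) ?_ ?_
    (bregman_lpPotential_nonneg h hp hq _ _)).trans ?_
  · rw [gradient_lpPotential hc.symm.lt, hy, dualityMap_dualityMap hc.symm]
  · linarith [bregman_radialProj_add_le h hp hq hu y,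
      bregman_lpPotential_nonneg h hp hq (radialProj q y) y]
  · gcongr

end LpStep

/-! ### Euclidean mirror descent on the cube -/

section CubeStep

variable {ι : Type} [Fintype ι]

/-- The Euclidean projection onto the cube `[-1, 1]^ι`. -/
noncomputable def cubeProj {ι : Type} (y : E ι) : E ι := WithLp.toLp 2 fun i => max (-1) (min 1 (y i))

lemma vecNorm_cubeProj_le_one (y : E ι) : vecNorm ∞ (cubeProj y) ≤ 1 := by
  rw [vecNorm_top_le_one_iff]
  intro i
  rw [abs_le]
  exact ⟨le_max_left _ _, max_le (by norm_num) (min_le_left _ _)⟩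

lemma measurable_cubeProj {κ : Type} : Measurable (cubeProj : E κ → E κ) :=
  (WithLp.measurable_toLp 2 _).comp (measurable_pi_lambda _ fun i => by fun_prop)

lemma gradient_lpPotential_two : gradient (lpPotential 2 : E ι → ℝ) = id := by
  refine gradient_eq fun w => ?_
  rw [hasGradientAt_iff_hasFDerivAt]
  have h : HasFDerivAt (fun v : E ι => ‖v‖ ^ 2 / 2) ((2 : ℝ)⁻¹ • (2 • innerSL ℝ w)) w := by
    have := (hasStrictFDerivAt_norm_sq w).hasFDerivAt.mul_const (2 : ℝ)⁻¹
    simpa only [← div_eq_mul_inv] using this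
  refine h.congr_fderiv ?_
  ext u
  simp

lemma bregman_lpPotential_two (u w : E ι) : bregman (lpPotential 2) u w = ‖u - w‖ ^ 2 / 2 := by
  rw [bregman, gradient_lpPotential_two, lpPotential, lpPotential, vecNorm_two, vecNorm_two,
    norm_sub_sq_real, inner_sub_right, id, real_inner_self_eq_norm_sq, real_inner_comm]
  ring

lemma bregman_cubeProj_add_le {u : E ι} (hu : vecNorm ∞ u ≤ 1) (y : E ι) :
    bregman (lpPotential 2) u (cubeProj y) + bregman (lpPotential 2) (cubeProj y) y ≤
      bregman (lpPotential 2) u y := by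
  rw [vecNorm_top_le_one_iff] at hu
  simp only [bregman_lpPotential_two, EuclideanSpace.norm_sq_eq, ← add_div,
    ← Finset.sum_add_distrib]
  gcongr with i
  obtain ⟨h₁, h₂⟩ := abs_le.1 (hu i)
  simp only [PiLp.sub_apply, cubeProj, Real.norm_eq_abs, sq_abs]
  rcases le_total (y i) 1 with h₃ | h₃
  · rw [min_eq_right h₃]
    rcases le_total (-1) (y i) with h₄ | h₄
    · rw [max_eq_right h₄]
      simp
    · rw [max_eq_left h₄]
      nlinarith
  · rw [min_eq_left h₃, max_eq_right (by norm_num)]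
    nlinarith

lemma mirrorStep_lpPotential_two (a : ℝ) (w g : E ι) :
    mirrorStep (lpPotential 2) Set.univ (lpUnitBall ∞) a w g = cubeProj (w - a • g) := by
  rw [mirrorStep, invFunOn_eq_of_injOn (y := w - a • g) _ (Set.mem_univ _) (by
    rw [gradient_lpPotential_two]; rfl)]
  · refine bregmanProj_eq ⟨vecNorm_cubeProj_le_one _, trivial⟩
      (fun u hu => bregman_cubeProj_add_le hu.1 _) (fun u _ => ?_) fun u _ h => ?_
    · rw [bregman_lpPotential_two]
      positivity
    · rw [bregman_lpPotential_two] at h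
      have : ‖u - cubeProj (w - a • g)‖ = 0 := by nlinarith [norm_nonneg (u - cubeProj (w - a • g))]
      exact sub_eq_zero.1 (norm_eq_zero.1 this)
  · rw [gradient_lpPotential_two]
    exact Set.injOn_id _

lemma regret_mirrorStep_lpPotential_two {a : ℝ} {u w g : E ι} (hu : vecNorm ∞ u ≤ 1)
    (hg : vecNorm 1 g ≤ 1) :
    a * inner ℝ g (w - u) ≤ bregman (lpPotential 2) u w -
      bregman (lpPotential 2) u (mirrorStep (lpPotential 2) Set.univ (lpUnitBall ∞) a w g) +
      a ^ 2 := by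
  rw [mirrorStep_lpPotential_two]
  have hnn : ∀ v w : E ι, 0 ≤ bregman (lpPotential 2) v w := fun v w => by
    rw [bregman_lpPotential_two]
    positivity
  -- `‖g‖_2 ^ 2 ≤ ‖g‖_1 ‖g‖_∞`, and the sup norm is at most the `ℓ_1` norm.
  have hgg : inner ℝ g g ≤ 1 := by
    have h₁ := inner_le_vecNorm_one_mul_vecNorm_top g g
    have h₂ : vecNorm ∞ g ≤ 1 := by
      rw [vecNorm_top_le_one_iff]
      exact fun i => (abs_apply_le_vecNorm g i).trans hg
    exact h₁.trans (mul_le_one₀ hg (vecNorm_nonneg g) h₂)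
  refine (mirror_step_regret (y := w - a • g) (w' := cubeProj (w - a • g)) ?_ ?_
    (hnn _ _)).trans ?_
  · rw [gradient_lpPotential_two]
    rfl
  · linarith [bregman_cubeProj_add_le hu (w - a • g), hnn (cubeProj (w - a • g)) (w - a • g)]
  · rw [sub_sub_cancel, inner_smul_right]
    nlinarith [sq_nonneg a]

end CubeStep

/-! ### Mirror descent with the entropy on the simplex -/

section EntropyStep

variable {ι : Type} [Fintype ι]

lemma hasGradientAt_entropyPotential {w : E ι} (hw : w ∈ posOrthant ι) :
    HasGradientAt entropyPotential (WithLp.toLp 2 fun i => Real.log (w i) + 1) w := by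
  have hsum : HasFDerivAt (entropyPotential : E ι → ℝ)
      (∑ i, (Real.log (w i) + 1) • (EuclideanSpace.proj i : E ι →L[ℝ] ℝ)) w := by
    refine HasFDerivAt.fun_sum fun i _ => ?_
    exact (Real.hasDerivAt_mul_log (hw i).ne').comp_hasFDerivAt w
      (EuclideanSpace.proj i : E ι →L[ℝ] ℝ).hasFDerivAt
  rw [hasGradientAt_iff_hasFDerivAt]
  refine hsum.congr_fderiv ?_
  ext u
  simp [inner_eq_sum]

lemma gradient_entropyPotential {w : E ι} (hw : w ∈ posOrthant ι) :
    gradient entropyPotential w = WithLp.toLp 2 fun i => Real.log (w i) + 1 :=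
  (hasGradientAt_entropyPotential hw).gradient

lemma bregman_entropyPotential (u : E ι) {w : E ι} (hw : w ∈ posOrthant ι) :
    bregman entropyPotential u w =
      ∑ i, (u i * Real.log (u i) - u i * Real.log (w i) - u i + w i) := by
  rw [bregman, gradient_entropyPotential hw, inner_eq_sum, entropyPotential, entropyPotential,
    ← Finset.sum_sub_distrib, ← Finset.sum_sub_distrib]
  refine Finset.sum_congr rfl fun i _ => ?_
  simp only [PiLp.sub_apply]
  ring

/-- This is `log x ≤ x - 1` at `x = w / u`, multiplied by `u`; at `u = 0` the convention `log 0 = 0`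
leaves `w`. -/
lemma relEntropy_term_nonneg {u w : ℝ} (hu : 0 ≤ u) (hw : 0 < w) :
    0 ≤ u * Real.log u - u * Real.log w - u + w := by
  rcases hu.eq_or_lt with rfl | hu
  · simpa using hw.le
  · have h := Real.log_le_sub_one_of_pos (div_pos hw hu)
    rw [Real.log_div hw.ne' hu.ne'] at h
    have := mul_le_mul_of_nonneg_left h hu.le
    rw [mul_sub, mul_sub, mul_div_cancel₀ _ hu.ne'] at this
    linarith

lemma eq_of_relEntropy_term_eq_zero {u w : ℝ} (hu : 0 < u) (hw : 0 < w)
    (h : u * Real.log u - u * Real.log w - u + w = 0) : u = w := by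
  by_contra hne
  have hlt := Real.log_lt_sub_one_of_pos (div_pos hw hu)
    (fun h => hne ((div_eq_one_iff_eq hu.ne').1 h).symm)
  rw [Real.log_div hw.ne' hu.ne'] at hlt
  have := mul_lt_mul_of_pos_left hlt hu
  rw [mul_sub, mul_sub, mul_div_cancel₀ _ hu.ne'] at this
  linarith

lemma bregman_entropyPotential_nonneg {u w : E ι} (hu : ∀ i, 0 ≤ u i) (hw : w ∈ posOrthant ι) :
    0 ≤ bregman entropyPotential u w := by
  rw [bregman_entropyPotential u hw]
  exact Finset.sum_nonneg fun i _ => relEntropy_term_nonneg (hu i) (hw i)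

lemma eq_of_bregman_entropyPotential_le_zero {u w : E ι} (hu : u ∈ posOrthant ι)
    (hw : w ∈ posOrthant ι) (h : bregman entropyPotential u w ≤ 0) : u = w := by
  have h₀ := le_antisymm h (bregman_entropyPotential_nonneg (fun i => (hu i).le) hw)
  rw [bregman_entropyPotential u hw, Finset.sum_eq_zero_iff_of_nonneg fun i _ =>
    relEntropy_term_nonneg (hu i).le (hw i)] at h₀
  ext i
  exact eq_of_relEntropy_term_eq_zero (hu i) (hw i) (h₀ i (Finset.mem_univ i))

/-- Normalization of the coordinate sum to one. -/
noncomputable def simplexProj (y : E ι) : E ι := (∑ i, y i)⁻¹ • y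

/-- The multiplicative weights update. -/
noncomputable def expUpdate {ι : Type} (a : ℝ) (w g : E ι) : E ι :=
  WithLp.toLp 2 fun i => w i * Real.exp (-(a * g i))

lemma expUpdate_mem_posOrthant {ι : Type} (a : ℝ) {w : E ι} (hw : w ∈ posOrthant ι) (g : E ι) :
    expUpdate a w g ∈ posOrthant ι := fun i => mul_pos (hw i) (Real.exp_pos _)

lemma sum_pos_of_mem_posOrthant [Nonempty ι] {y : E ι} (hy : y ∈ posOrthant ι) : 0 < ∑ i, y i :=
  Finset.sum_pos (fun i _ => hy i) Finset.univ_nonempty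

lemma simplexProj_mem [Nonempty ι] {y : E ι} (hy : y ∈ posOrthant ι) :
    simplexProj y ∈ simplex ι ∩ posOrthant ι := by
  have hS := sum_pos_of_mem_posOrthant hy
  have hpos : simplexProj y ∈ posOrthant ι := fun i => mul_pos (inv_pos.2 hS) (hy i)
  refine ⟨⟨fun i => (hpos i).le, ?_⟩, hpos⟩
  simp only [simplexProj, PiLp.smul_apply, smul_eq_mul, ← Finset.mul_sum]
  exact inv_mul_cancel₀ hS.ne'

/-- Normalization shifts every logarithm by the same constant, and `u` and `simplexProj y` have
equal coordinate sums, so the Pythagorean relation is an equality. -/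
lemma bregman_simplexProj_add [Nonempty ι] {u y : E ι} (hu : u ∈ simplex ι)
    (hy : y ∈ posOrthant ι) :
    bregman entropyPotential u (simplexProj y) + bregman entropyPotential (simplexProj y) y =
      bregman entropyPotential u y := by
  obtain ⟨⟨-, h₁⟩, hpos⟩ := simplexProj_mem hy
  have hS := sum_pos_of_mem_posOrthant hy
  rw [bregman_entropyPotential _ hpos, bregman_entropyPotential _ hy,
    bregman_entropyPotential _ hy, ← sub_eq_zero, ← Finset.sum_add_distrib,
    ← Finset.sum_sub_distrib]
  have hlog : ∀ i, Real.log (simplexProj y i) = Real.log (y i) - Real.log (∑ i, y i) := fun i => by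
    rw [simplexProj, PiLp.smul_apply, smul_eq_mul, Real.log_mul (inv_pos.2 hS).ne' (hy i).ne',
      Real.log_inv]
    ring
  calc _ = ∑ i, (u i - simplexProj y i) * Real.log (∑ i, y i) := by
        refine Finset.sum_congr rfl fun i _ => ?_
        rw [hlog i]
        ring
    _ = 0 := by rw [← Finset.sum_mul, Finset.sum_sub_distrib, hu.2, h₁, sub_self, zero_mul]

lemma gradient_expUpdate (a : ℝ) {w : E ι} (hw : w ∈ posOrthant ι) (g : E ι) :
    gradient entropyPotential (expUpdate a w g) = gradient entropyPotential w - a • g := by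
  rw [gradient_entropyPotential (expUpdate_mem_posOrthant a hw g), gradient_entropyPotential hw]
  ext i
  simp only [expUpdate, PiLp.sub_apply, PiLp.smul_apply, smul_eq_mul]
  rw [Real.log_mul (hw i).ne' (Real.exp_pos _).ne', Real.log_exp]
  ring

lemma mirrorStep_entropyPotential [Nonempty ι] (a : ℝ) {w : E ι} (hw : w ∈ posOrthant ι)
    (g : E ι) :
    mirrorStep entropyPotential (posOrthant ι) (simplex ι) a w g =
      simplexProj (expUpdate a w g) := by
  have hy := expUpdate_mem_posOrthant a hw g
  have hw' := simplexProj_mem hy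
  rw [mirrorStep, invFunOn_eq_of_injOn ?_ hy (gradient_expUpdate a hw g)]
  · exact bregmanProj_eq hw' (fun u hu => (bregman_simplexProj_add hu.1 hy).le)
      (fun u hu => bregman_entropyPotential_nonneg hu.1.1 hw'.2)
      fun u hu => eq_of_bregman_entropyPotential_le_zero hu.2 hw'.2
  · intro u hu v hv huv
    rw [gradient_entropyPotential hu, gradient_entropyPotential hv] at huv
    ext i
    have hi := congrArg (fun x : E ι => x i) huv
    exact Real.log_injOn_pos (hu i) (hv i) (add_right_cancel hi)

lemma regret_mirrorStep_entropyPotential [Nonempty ι] {a : ℝ} (ha₀ : 0 ≤ a) (ha : a ≤ 1)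
    {u w g : E ι} (hu : u ∈ simplex ι) (hw : w ∈ simplex ι ∩ posOrthant ι)
    (hg : ∀ i, |g i| ≤ 1) :
    a * inner ℝ g (w - u) ≤ bregman entropyPotential u w -
      bregman entropyPotential u (mirrorStep entropyPotential (posOrthant ι) (simplex ι) a w g) +
      a * (2 * a) := by
  have hy := expUpdate_mem_posOrthant a hw.2 g
  have hw' := simplexProj_mem hy
  rw [mirrorStep_entropyPotential a hw.2]
  -- Coordinatewise `|exp s - 1| ≤ 2 |s|` for `|s| ≤ 1`; the weights `w i` sum to one, so no
  -- dimension factor appears.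
  have hbound : inner ℝ g (w - expUpdate a w g) ≤ 2 * a := by
    rw [inner_eq_sum, ← mul_one (2 * a), ← hw.1.2, Finset.mul_sum]
    refine Finset.sum_le_sum fun i _ => ?_
    have hag : |-(a * g i)| ≤ a := by
      rw [abs_neg, abs_mul, abs_of_nonneg ha₀]
      exact mul_le_of_le_one_right ha₀ (hg i)
    have hexp := (Real.abs_exp_sub_one_le (hag.trans ha)).trans
      (mul_le_mul_of_nonneg_left hag zero_le_two)
    have h : g i * (w - expUpdate a w g) i = -(g i * (Real.exp (-(a * g i)) - 1)) * w i := by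
      simp only [expUpdate, PiLp.sub_apply]
      ring
    rw [h]
    refine mul_le_mul_of_nonneg_right ((neg_le_abs _).trans ?_) (hw.1.1 i)
    rw [abs_mul]
    exact (mul_le_of_le_one_left (abs_nonneg _) (hg i)).trans hexp
  refine (mirror_step_regret (y := expUpdate a w g) (w' := simplexProj (expUpdate a w g))
    (gradient_expUpdate a hw.2 g) ?_
    (bregman_entropyPotential_nonneg (fun i => (hy i).le) hw.2)).trans ?_
  · linarith [bregman_simplexProj_add hu hy,
      bregman_entropyPotential_nonneg (u := simplexProj (expUpdate a w g))
        (fun i => (hw'.2 i).le) hy]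
  · gcongr

lemma uniformPoint_mem [Nonempty ι] : uniformPoint ι ∈ simplex ι ∩ posOrthant ι := by
  have hn : (0 : ℝ) < Fintype.card ι := by exact_mod_cast Fintype.card_pos
  refine ⟨⟨fun i => (inv_pos.2 hn).le, ?_⟩, fun i => inv_pos.2 hn⟩
  simp [uniformPoint, hn.ne']

lemma bregman_uniformPoint_le [Nonempty ι] {u : E ι} (hu : u ∈ simplex ι) :
    bregman entropyPotential u (uniformPoint ι) ≤ Real.log (Fintype.card ι) := by
  rw [bregman_entropyPotential u uniformPoint_mem.2]
  have h : ∀ i, u i * Real.log (u i) - u i * Real.log (uniformPoint ι i) - u i + uniformPoint ι i ≤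
      u i * Real.log (Fintype.card ι) - u i + uniformPoint ι i := fun i => by
    have h₁ : u i ≤ 1 := by
      rw [← hu.2]
      exact Finset.single_le_sum (fun j _ => hu.1 j) (Finset.mem_univ i)
    have := mul_nonpos_of_nonneg_of_nonpos (hu.1 i) (Real.log_nonpos (hu.1 i) h₁)
    simp only [uniformPoint, Real.log_inv]
    linarith
  refine (Finset.sum_le_sum fun i _ => h i).trans ?_
  rw [Finset.sum_add_distrib, Finset.sum_sub_distrib, ← Finset.sum_mul, hu.2,
    uniformPoint_mem.1.2]
  linarith

lemma measurable_simplexProj : Measurable (simplexProj : E ι → E ι) := by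
  unfold simplexProj
  fun_prop

end EntropyStep

/-! ### Adaptive iterates and their regret -/

/-- The states of a recursion driven by the samples `z 0, z 1, …`. -/
def recIter {S Z : Type} (Φ : S → Z → S) (s₀ : S) (z : ℕ → Z) : ℕ → S
  | 0 => s₀
  | k + 1 => Φ (recIter Φ s₀ z k) (z k)

lemma recIter_congr {S Z : Type} (Φ : S → Z → S) (s₀ : S) {z z' : ℕ → Z} :
    ∀ k, (∀ i < k, z i = z' i) → recIter Φ s₀ z k = recIter Φ s₀ z' k
  | 0, _ => rfl
  | k + 1, h => by
    rw [recIter, recIter, recIter_congr Φ s₀ k fun i hi => h i (hi.trans k.lt_succ_self),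
      h k k.lt_succ_self]

lemma measurable_recIter {S Z : Type} [MeasurableSpace S] [MeasurableSpace Z] {Φ : S → Z → S}
    (hΦ : Measurable (Function.uncurry Φ)) (s₀ : S) :
    ∀ k, Measurable fun z : ℕ → Z => recIter Φ s₀ z k
  | 0 => measurable_const
  | k + 1 => hΦ.comp ((measurable_recIter hΦ s₀ k).prodMk (measurable_pi_apply k))

/-- The derivative of the surrogate loss at `w` in the direction `w - wstar`. -/
noncomputable def directionalLoss {d : ℕ} (γ η : ℝ) (wstar w : E (Fin d))
    (z : E (Fin d) × ℝ) : ℝ :=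
  residual γ η (inner ℝ w z.1) z.2 * (inner ℝ w z.1 - inner ℝ wstar z.1)

/-- Iterates in the `ℓ_q` unit ball that are measurable functions of the preceding samples, average
to the output of stochastic mirror descent, and have regret at most `D + T * b`. -/
structure IsRegretBounded {d : ℕ} (p q : ℝ≥0∞) (γ η a D b : ℝ)
    (W : ℕ → (ℕ → E (Fin d) × ℝ) → E (Fin d)) : Prop where
  measurable : ∀ k, Measurable (W k)
  adapted : ∀ k z z', (∀ i < k, z i = z' i) → W k z = W k z'
  vecNorm_le_one : ∀ k z, vecNorm q (W k z) ≤ 1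
  average : ∀ (T : ℕ) z,
    smdHalfspace q γ η a T z = (T : ℝ)⁻¹ • ∑ k ∈ Finset.range T, W k z
  regret : ∀ wstar, vecNorm q wstar = 1 → ∀ (T : ℕ) (z : ℕ → E (Fin d) × ℝ),
    (∀ k, vecNorm p (z k).1 ≤ 1 ∧ ((z k).2 = 1 ∨ (z k).2 = -1)) →
    ∑ k ∈ Finset.range T, directionalLoss γ η wstar (W k z) (z k) ≤ D + T * b

lemma measurable_residual {γ : ℝ} (η : ℝ) (hγ : 0 < γ) :
    Measurable fun x : ℝ × ℝ => residual γ η x.1 x.2 := by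
  have := (continuous_link η hγ).measurable
  unfold residual
  fun_prop

lemma measurable_residual_smul {d : ℕ} {γ : ℝ} (η : ℝ) (hγ : 0 < γ) :
    Measurable fun x : E (Fin d) × (E (Fin d) × ℝ) =>
      residual γ η (inner ℝ x.1 x.2.1) x.2.2 • x.2.1 := by
  have h := (measurable_residual η hγ).comp
    (show Measurable fun x : E (Fin d) × (E (Fin d) × ℝ) => ((inner ℝ x.1 x.2.1 : ℝ), x.2.2) by
      fun_prop)
  exact h.smul (by fun_prop)

lemma sum_le_of_mul_le {a D b' : ℝ} {T : ℕ} {f : ℕ → ℝ} (ha : 0 < a)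
    (h : ∑ k ∈ Finset.range T, a * f k ≤ D + T * (a * b')) :
    ∑ k ∈ Finset.range T, f k ≤ D / a + T * b' := by
  rw [← Finset.mul_sum] at h
  have : D + T * (a * b') = a * (D / a + T * b') := by field_simp
  rw [this] at h
  exact le_of_mul_le_mul_left h ha

/-- Mirror descent on the `ℓ_q` ball with a potential that is defined everywhere. -/
lemma isRegretBounded_smdIterate {d : ℕ} {p q : ℝ≥0∞} [Fact (1 ≤ p)] {γ η a D b : ℝ} (hγ : 0 < γ)
    (hη₀ : 0 ≤ η) (hη : η < 1 / 2) (ha : 0 < a) {ψ : E (Fin d) → ℝ}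
    {step : E (Fin d) → E (Fin d) → E (Fin d)}
    (hsmd : ∀ (T : ℕ) z, smdHalfspace q γ η a T z =
      smdAverage ψ Set.univ (lpUnitBall q) 0 a (glmLoss γ η) T z)
    (hstep : ∀ w g, mirrorStep ψ Set.univ (lpUnitBall q) a w g = step w g)
    (hmeas : Measurable (Function.uncurry step))
    (hzero : vecNorm q (0 : E (Fin d)) ≤ 1) (hball : ∀ w g, vecNorm q (step w g) ≤ 1)
    (hnonneg : ∀ u w, 0 ≤ bregman ψ u w)
    (hinit : ∀ u, vecNorm q u ≤ 1 → bregman ψ u 0 ≤ D)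
    (hregret : ∀ u w g, vecNorm q u ≤ 1 → vecNorm q w ≤ 1 → vecNorm p g ≤ 1 →
      a * inner ℝ g (w - u) ≤ bregman ψ u w -
        bregman ψ u (mirrorStep ψ Set.univ (lpUnitBall q) a w g) + a * b) :
    ∃ W : ℕ → (ℕ → E (Fin d) × ℝ) → E (Fin d), IsRegretBounded p q γ η a (D / a) b W := by
  -- The iterates are rewritten with the explicit step and gradient, since measurability in the
  -- samples is not visible through `mirrorStep`, which involves choices.
  set Φ : E (Fin d) → E (Fin d) × ℝ → E (Fin d) := fun w z =>
    step w (residual γ η (inner ℝ w z.1) z.2 • z.1) with hΦ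
  have hiter : ∀ z k, smdIterate ψ Set.univ (lpUnitBall q) 0 a (glmLoss γ η) z k =
      recIter Φ 0 z k := by
    intro z k
    induction k with
    | zero => rfl
    | succ k ih => simp only [smdIterate, recIter, ih, hΦ, hstep, gradient_glmLoss η hγ]
  have hΦm : Measurable (Function.uncurry Φ) :=
    hmeas.comp (measurable_fst.prodMk (measurable_residual_smul η hγ))
  have hnorm : ∀ k z, vecNorm q (recIter Φ 0 z k) ≤ 1 := fun k z => by
    cases k with
    | zero => exact hzero
    | succ k => exact hball _ _
  refine ⟨fun k z => recIter Φ 0 z k, measurable_recIter hΦm 0,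
    fun k z z' h => recIter_congr Φ 0 k h, hnorm, fun T z => ?_, fun u hu T z hz => ?_⟩
  · simp only [hsmd, smdAverage, hiter]
  · have h := sum_mirror_step_regret (ψ := ψ) (a := a) (b := a * b) (u := u)
      (w := recIter Φ 0 z)
      (g := fun k => residual γ η (inner ℝ (recIter Φ 0 z k) (z k).1) (z k).2 • (z k).1) T
      (fun k => by
        refine (hregret u _ _ hu.le (hnorm k z) ?_).trans_eq ?_
        · rw [vecNorm_smul]
          exact mul_le_one₀ (abs_residual_le_one hγ hη₀ hη (hz k).2 _) (vecNorm_nonneg _) (hz k).1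
        · rw [hstep]
          rfl)
      (hnonneg _ _)
    have h' := sum_le_of_mul_le ha (h.trans (add_le_add_left (hinit u hu.le) _))
    refine le_trans (le_of_eq (Finset.sum_congr rfl fun k _ => ?_)) h'
    rw [directionalLoss, inner_smul_left, inner_sub_right, conj_trivial, real_inner_comm,
      real_inner_comm (z k).1 u]

/-! ### Signed weights: the `ℓ_1` ball and the simplex of `ℝ²ᵈ`. -/

lemma signedPart_smul {d : ℕ} (c : ℝ) (v : E (Fin d ⊕ Fin d)) :
    signedPart (c • v) = c • signedPart v := by
  ext i
  simp [signedPart, mul_sub]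

lemma signedPart_sum {d : ℕ} {α : Type*} (s : Finset α) (f : α → E (Fin d ⊕ Fin d)) :
    signedPart (∑ k ∈ s, f k) = ∑ k ∈ s, signedPart (f k) := by
  ext i
  simp [signedPart]

lemma vecNorm_signedPart_le_one {d : ℕ} {v : E (Fin d ⊕ Fin d)}
    (hv : v ∈ simplex (Fin d ⊕ Fin d)) : vecNorm 1 (signedPart v) ≤ 1 := by
  rw [vecNorm_one, ← hv.2, Fintype.sum_sum_type, ← Finset.sum_add_distrib]
  refine Finset.sum_le_sum fun i _ => (abs_sub _ _).trans ?_
  rw [abs_of_nonneg (hv.1 _), abs_of_nonneg (hv.1 _)]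

lemma exists_mem_simplex_signedPart_eq {d : ℕ} {w : E (Fin d)} (hw : vecNorm 1 w = 1) :
    ∃ v ∈ simplex (Fin d ⊕ Fin d), signedPart v = w := by
  refine ⟨WithLp.toLp 2 (Sum.elim (fun i => max (w i) 0) fun i => max (-w i) 0), ⟨?_, ?_⟩, ?_⟩
  · rintro (i | i) <;> exact le_max_right _ _
  · rw [Fintype.sum_sum_type, ← Finset.sum_add_distrib, ← hw, vecNorm_one]
    refine Finset.sum_congr rfl fun i _ => ?_
    simp
  · ext i
    simp [signedPart]

lemma measurable_signedPart {d : ℕ} : Measurable (signedPart : E (Fin d ⊕ Fin d) → E (Fin d)) :=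
  (WithLp.measurable_toLp 2 _).comp (measurable_pi_lambda _ fun i => by fun_prop)

lemma measurable_signedLift {d : ℕ} : Measurable (signedLift : E (Fin d) → E (Fin d ⊕ Fin d)) := by
  refine (WithLp.measurable_toLp 2 _).comp (measurable_pi_lambda _ ?_)
  rintro (i | i)
  · simp only [Sum.elim_inl]
    fun_prop
  · simp only [Sum.elim_inr]
    fun_prop

lemma measurable_expUpdate {ι : Type} (a : ℝ) :
    Measurable fun x : E ι × E ι => expUpdate a x.1 x.2 :=
  (WithLp.measurable_toLp 2 _).comp (measurable_pi_lambda _ fun i => by fun_prop)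

/-- Mirror descent with the entropy on the simplex of signed weights. -/
lemma isRegretBounded_entropy {d : ℕ} [Nonempty (Fin d ⊕ Fin d)] {γ η a : ℝ} (hγ : 0 < γ)
    (hη₀ : 0 ≤ η) (hη : η < 1 / 2) (ha₀ : 0 < a) (ha : a ≤ 1) :
    ∃ W : ℕ → (ℕ → E (Fin d) × ℝ) → E (Fin d), IsRegretBounded ∞ 1 γ η a
      (Real.log (Fintype.card (Fin d ⊕ Fin d)) / a) (2 * a) W := by
  set ι := Fin d ⊕ Fin d
  set grad : E ι → E (Fin d) × ℝ → E ι := fun v z =>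
    residual γ η (inner ℝ (signedPart v) z.1) z.2 • signedLift z.1 with hgrad
  set Φ : E ι → E (Fin d) × ℝ → E ι := fun v z => simplexProj (expUpdate a v (grad v z)) with hΦ
  have hmem : ∀ z k, recIter Φ (uniformPoint ι) z k ∈ simplex ι ∩ posOrthant ι := by
    intro z k
    induction k with
    | zero => exact uniformPoint_mem
    | succ k ih => exact simplexProj_mem (expUpdate_mem_posOrthant a ih.2 _)
  have hstep : ∀ z k, mirrorStep entropyPotential (posOrthant ι) (simplex ι) a
      (recIter Φ (uniformPoint ι) z k) (grad (recIter Φ (uniformPoint ι) z k) (z k)) =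
      recIter Φ (uniformPoint ι) z (k + 1) := fun z k =>
    mirrorStep_entropyPotential a (hmem z k).2 _
  have hiter : ∀ z k, smdIterate entropyPotential (posOrthant ι) (simplex ι) (uniformPoint ι) a
      (fun v => glmLoss γ η (signedPart v)) z k = recIter Φ (uniformPoint ι) z k := by
    intro z k
    induction k with
    | zero => rfl
    | succ k ih =>
      rw [← hstep]
      simp only [smdIterate, ih]
      exact congrArg _ (gradient_glmLoss_signedPart η hγ _ _)
  have hgradm : Measurable fun x : E ι × (E (Fin d) × ℝ) => grad x.1 x.2 := by
    have h := (measurable_residual η hγ).comp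
      (show Measurable fun x : E ι × (E (Fin d) × ℝ) =>
        ((inner ℝ (signedPart x.1) x.2.1 : ℝ), x.2.2) by
          have := measurable_signedPart (d := d)
          fun_prop)
    exact h.smul (measurable_signedLift.comp (by fun_prop))
  have hΦm : Measurable (Function.uncurry Φ) :=
    measurable_simplexProj.comp ((measurable_expUpdate a).comp (measurable_fst.prodMk hgradm))
  refine ⟨fun k z => signedPart (recIter Φ (uniformPoint ι) z k),
    fun k => measurable_signedPart.comp (measurable_recIter hΦm _ k),
    fun k z z' h => congrArg signedPart (recIter_congr Φ _ k h),
    fun k z => vecNorm_signedPart_le_one (hmem z k).1, fun T z => ?_, fun wstar hw T z hz => ?_⟩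
  · rw [smdHalfspace, if_pos rfl, smdAverage, signedPart_smul, signedPart_sum]
    exact congrArg _ (Finset.sum_congr rfl fun k _ => congrArg _ (hiter z k))
  · obtain ⟨u, hu, rfl⟩ := exists_mem_simplex_signedPart_eq hw
    have h := sum_mirror_step_regret (ψ := entropyPotential) (a := a) (b := a * (2 * a)) (u := u)
      (w := recIter Φ (uniformPoint ι) z)
      (g := fun k => grad (recIter Φ (uniformPoint ι) z k) (z k)) T
      (fun k => by
        rw [← hstep]
        refine regret_mirrorStep_entropyPotential ha₀.le ha hu (hmem z k) fun i => ?_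
        have hx : |signedLift (z k).1 i| ≤ 1 := by
          have := vecNorm_top_le_one_iff.1 (hz k).1
          rcases i with i | i
          · simpa [signedLift] using this i
          · simpa [signedLift] using this i
        simp only [hgrad, PiLp.smul_apply, smul_eq_mul, abs_mul]
        exact mul_le_one₀ (abs_residual_le_one hγ hη₀ hη (hz k).2 _) (abs_nonneg _) hx)
      (bregman_entropyPotential_nonneg hu.1 (hmem z T).2)
    have h' := sum_le_of_mul_le ha₀ (h.trans (add_le_add_left (bregman_uniformPoint_le hu) _))
    refine le_trans (le_of_eq (Finset.sum_congr rfl fun k _ => ?_)) h'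
    simp only [hgrad]
    rw [directionalLoss, inner_smul_left, inner_sub_right, conj_trivial, ← inner_signedPart,
      ← inner_signedPart]

/-- The regret of stochastic mirror descent, with constants that depend on `d` and `q` only. -/
lemma exists_isRegretBounded (d : ℕ) {p q : ℝ≥0∞} (h : ENNReal.HolderConjugate p q) :
    ∃ M D t : ℝ, 1 ≤ M ∧ 1 ≤ D ∧ 0 < t ∧ t ≤ 1 ∧ 1 + 1 / t = rateExponent q ∧
      ∀ γ η a : ℝ, 0 < γ → 0 ≤ η → η < 1 / 2 → 0 < a → a ≤ 1 →
        ∃ W : ℕ → (ℕ → E (Fin d) × ℝ) → E (Fin d),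
          IsRegretBounded p q γ η a (D / a) (M * a ^ t) W := by
  have : Fact (1 ≤ p) := ⟨ENNReal.HolderConjugate.one_le p q⟩
  have : Fact (1 ≤ q) := ⟨ENNReal.HolderConjugate.one_le q p⟩
  have h' := ENNReal.HolderConjugate.inv_add_inv_eq_one p q
  by_cases hq₁ : q = 1
  · subst hq₁
    obtain rfl : p = ∞ := by simpa using h'
    refine ⟨2, |Real.log (Fintype.card (Fin d ⊕ Fin d))| + 1, 1, by norm_num,
      by linarith [abs_nonneg (Real.log (Fintype.card (Fin d ⊕ Fin d)))], one_pos, le_rfl,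
      by norm_num [rateExponent], fun γ η a hγ hη₀ hη ha₀ ha => ?_⟩
    -- In dimension zero the simplex is empty, but no comparator of norm one exists either, so the
    -- regret bound is vacuous.
    rcases d.eq_zero_or_pos with rfl | hd
    · refine ⟨fun _ _ => 0, fun k => measurable_const, fun _ _ _ _ => rfl, fun k z => by simp,
        fun T z => Subsingleton.elim _ _, fun w hw => ?_⟩
      rw [Subsingleton.elim w 0, vecNorm_zero] at hw
      exact absurd hw zero_ne_one
    · have : Nonempty (Fin d ⊕ Fin d) := ⟨Sum.inl ⟨0, hd⟩⟩
      obtain ⟨W, h₁, h₂, h₃, h₄, h₅⟩ := isRegretBounded_entropy (d := d) hγ hη₀ hη ha₀ ha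
      refine ⟨W, h₁, h₂, h₃, h₄, fun w hw T z hz => (h₅ w hw T z hz).trans ?_⟩
      rw [Real.rpow_one]
      gcongr
      linarith [le_abs_self (Real.log (Fintype.card (Fin d ⊕ Fin d)))]
  by_cases hq : q = ∞
  · subst hq
    obtain rfl : p = 1 := by simpa using h'
    refine ⟨1, d + 1, 1, le_rfl, by simp, one_pos, le_rfl, by norm_num [rateExponent],
      fun γ η a hγ hη₀ hη ha₀ ha => ?_⟩
    refine isRegretBounded_smdIterate hγ hη₀ hη ha₀ (ψ := lpPotential 2)
      (step := fun w g => cubeProj (w - a • g)) (fun T z => ?_) (mirrorStep_lpPotential_two a)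
      (measurable_cubeProj.comp (by fun_prop)) (by simp) (fun w g => vecNorm_cubeProj_le_one _)
      (fun u w => ?_) (fun u hu => ?_) fun u w g hu hw hg => ?_
    · rw [smdHalfspace, if_neg ENNReal.top_ne_one, if_pos rfl]
    · rw [bregman_lpPotential_two]
      positivity
    · rw [bregman_lpPotential_two, sub_zero, EuclideanSpace.norm_sq_eq]
      have hsum : ∑ i, ‖u i‖ ^ 2 ≤ d := by
        refine (Finset.sum_le_card_nsmul Finset.univ _ 1 fun i _ => ?_).trans_eq (by simp)
        exact pow_le_one₀ (norm_nonneg _) (vecNorm_top_le_one_iff.1 hu i)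
      linarith [(Nat.cast_nonneg d : (0 : ℝ) ≤ d)]
    · refine (regret_mirrorStep_lpPotential_two hu hg).trans_eq ?_
      rw [Real.rpow_one]
      ring
  have hp : p ≠ ∞ := by
    rintro rfl
    exact hq₁ (by simpa using h')
  have hc := toReal_holderConjugate h hp hq
  have hp₁ := hc.sub_one_pos
  have hC : 0 ≤ (d : ℝ) * (1 + 4 * p.toReal) := by
    have := hc.pos
    positivity
  refine ⟨1 + d * (1 + 4 * p.toReal), 1, min 1 (p.toReal - 1), by linarith, le_rfl,
    lt_min one_pos hp₁, min_le_left _ _, ?_, fun γ η a hγ hη₀ hη ha₀ ha => ?_⟩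
  · rw [rateExponent, if_neg hq]
    -- This identity converts the Hölder exponent `p - 1` of the inverse mirror map into the
    -- sample-size exponent `q`.
    have hconj : q.toReal = 1 + 1 / (p.toReal - 1) := by
      rw [hc.conjugate_eq]
      field_simp
      ring
    rcases le_total 1 (p.toReal - 1) with hle | hle
    · rw [min_eq_left hle, max_eq_left]
      · norm_num
      · rw [hconj]
        have := (div_le_one hp₁).2 hle
        linarith
    · rw [min_eq_right hle, max_eq_right, hconj]
      rw [hconj]
      have := (one_le_div hp₁).2 hle
      linarith
  · refine isRegretBounded_smdIterate hγ hη₀ hη ha₀ (ψ := lpPotential q)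
      (step := fun w g => radialProj q (dualityMap p (dualityMap q w - a • g))) (fun T z => ?_)
      (mirrorStep_lpPotential h hp hq a)
      (measurable_radialProj.comp ((measurable_dualityMap hc.lt).comp ?_)) (by simp)
      (fun w g => vecNorm_radialProj_le_one _) (bregman_lpPotential_nonneg h hp hq)
      (fun u hu => ?_) fun u w g hu hw hg => ?_
    · rw [smdHalfspace, if_neg hq₁, if_neg hq]
    · exact ((measurable_dualityMap hc.symm.lt).comp measurable_fst).sub
        (measurable_snd.const_smul a)
    · rw [bregman_lpPotential hc.symm.lt, dualityMap_zero, inner_zero_left, vecNorm_zero]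
      nlinarith [vecNorm_nonneg (q := q) u]
    · refine (regret_mirrorStep_lpPotential h hp hq ha₀.le ha hu hw hg).trans ?_
      rw [Fintype.card_fin, ← mul_assoc (d : ℝ)]
      gcongr
      linarith

/-! ### Concentration for adaptive sums -/

section Concentration

variable {Ω α β : Type} [MeasurableSpace Ω] [MeasurableSpace α] [MeasurableSpace β]
  {P : Measure Ω} {Z : ℕ → Ω → α}

/-- `G` ignores the coordinates from `k` on, so these may be filled with an arbitrary value; then
`G` is a function of finitely many samples, all independent of the `k`-th. -/
lemma indepFun_of_adapted [Nonempty α] (hZ : ∀ k, Measurable (Z k)) (hind : iIndepFun Z P) {k : ℕ}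
    {G : (ℕ → α) → β} (hG : Measurable G)
    (hadapted : ∀ z z', (∀ i < k, z i = z' i) → G z = G z') :
    IndepFun (fun ω => G fun i => Z i ω) (Z k) P := by
  classical
  have h := hind.indepFun_finset (Finset.range k) {k} (by simp) hZ
  set ext : (Finset.range k → α) → ℕ → α := fun z i =>
    if hi : i ∈ Finset.range k then z ⟨i, hi⟩ else Classical.arbitrary α
  have hext : Measurable ext := measurable_pi_lambda _ fun i => by
    by_cases hi : i ∈ Finset.range k
    · simpa only [ext, dif_pos hi] using measurable_pi_apply _
    · simpa only [ext, dif_neg hi] using measurable_const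
  have heval : Measurable fun z : ({k} : Finset ℕ) → α => z ⟨k, Finset.mem_singleton_self k⟩ :=
    measurable_pi_apply _
  have h' := h.comp (hG.comp hext) heval
  refine h'.congr (Filter.Eventually.of_forall fun ω => hadapted _ _ fun i hi => ?_) (by rfl)
  simp [ext, hi]

variable [IsProbabilityMeasure P]

/-- The exponential moment step of Azuma–Hoeffding, with Fubini's theorem for the fresh sample in
place of conditional expectations. -/
lemma lintegral_exp_adapted_sum_le {μ : Measure α} (hZ : ∀ k, Measurable (Z k))
    (hind : iIndepFun Z P) (hlaw : ∀ k, P.map (Z k) = μ) {W : ℕ → (ℕ → α) → β}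
    (hW : ∀ k, Measurable (W k)) (hadapted : ∀ k z z', (∀ i < k, z i = z' i) → W k z = W k z')
    {φ : β → α → ℝ} (hφ : Measurable (Function.uncurry φ)) {t c : ℝ}
    (hmgf : ∀ k z, ∫⁻ x, ENNReal.ofReal (Real.exp (t * φ (W k z) x)) ∂μ ≤
      ENNReal.ofReal (Real.exp c)) (T : ℕ) :
    ∫⁻ ω, ENNReal.ofReal (Real.exp (t * ∑ k ∈ Finset.range T,
      φ (W k fun i => Z i ω) (Z k ω))) ∂P ≤ ENNReal.ofReal (Real.exp (T * c)) := by
  obtain ⟨ω₀⟩ : Nonempty Ω := P.nonempty_of_neZero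
  have : Nonempty α := ⟨Z 0 ω₀⟩
  have : IsProbabilityMeasure μ := by
    rw [← hlaw 0]
    exact Measure.isProbabilityMeasure_map (hZ 0).aemeasurable
  have hseq : Measurable fun ω i => Z i ω := measurable_pi_lambda _ hZ
  induction T with
  | zero => simp
  | succ T ih =>
    -- The current state and the partial sum are carried jointly, because both must be independent
    -- of the sample `Z T`.
    set G : (ℕ → α) → β × ℝ := fun z => (W T z, ∑ k ∈ Finset.range T, φ (W k z) (z k)) with hGdef
    have hG : Measurable G := (hW T).prodMk <| Finset.measurable_fun_sum _ fun k _ =>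
      hφ.comp ((hW k).prodMk (measurable_pi_apply k))
    have hGa : ∀ z z', (∀ i < T, z i = z' i) → G z = G z' := fun z z' h => by
      refine Prod.ext (hadapted T z z' h) ?_
      simp only [hGdef]
      refine Finset.sum_congr rfl fun k hk => ?_
      have hk := Finset.mem_range.1 hk
      rw [hadapted k z z' fun i hi => h i (hi.trans hk), h k hk]
    have hprod := (indepFun_iff_map_prod_eq_prod_map_map (hG.comp hseq).aemeasurable
      (hZ T).aemeasurable).1 (indepFun_of_adapted hZ hind hG hGa)
    set f : (β × ℝ) × α → ℝ≥0∞ := fun x =>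
      ENNReal.ofReal (Real.exp (t * x.1.2)) * ENNReal.ofReal (Real.exp (t * φ x.1.1 x.2)) with hf
    have hφ' : Measurable fun x : (β × ℝ) × α => φ x.1.1 x.2 :=
      hφ.comp ((measurable_fst.comp measurable_fst).prodMk measurable_snd)
    have hfm : Measurable f := by fun_prop
    calc ∫⁻ ω, ENNReal.ofReal (Real.exp (t * ∑ k ∈ Finset.range (T + 1),
          φ (W k fun i => Z i ω) (Z k ω))) ∂P
        = ∫⁻ ω, f (G fun i => Z i ω, Z T ω) ∂P := by
          refine lintegral_congr fun ω => ?_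
          rw [Finset.sum_range_succ, mul_add, Real.exp_add, ENNReal.ofReal_mul (Real.exp_nonneg _)]
      _ = ∫⁻ x, f x ∂(P.map fun ω => (G fun i => Z i ω, Z T ω)) :=
          (lintegral_map hfm ((hG.comp hseq).prodMk (hZ T))).symm
      _ = ∫⁻ u, ∫⁻ x, f (u, x) ∂μ ∂(P.map fun ω => G fun i => Z i ω) := by
          have hprod' : P.map (fun ω => (G fun i => Z i ω, Z T ω)) =
              (P.map fun ω => G fun i => Z i ω).prod μ := by rw [← hlaw T]; exact hprod
          rw [hprod', lintegral_prod _ hfm.aemeasurable]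
      _ = ∫⁻ ω, ∫⁻ x, f (G fun i => Z i ω, x) ∂μ ∂P :=
          lintegral_map hfm.lintegral_prod_right' (hG.comp hseq)
      _ ≤ ∫⁻ ω, ENNReal.ofReal (Real.exp (t * ∑ k ∈ Finset.range T,
            φ (W k fun i => Z i ω) (Z k ω))) * ENNReal.ofReal (Real.exp c) ∂P := by
          refine lintegral_mono fun ω => ?_
          simp only [hf, hGdef]
          rw [lintegral_const_mul' _ _ ENNReal.ofReal_ne_top]
          gcongr
          exact hmgf T _
      _ ≤ ENNReal.ofReal (Real.exp (T * c)) * ENNReal.ofReal (Real.exp c) := by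
          rw [lintegral_mul_const' _ _ ENNReal.ofReal_ne_top]
          gcongr
      _ = ENNReal.ofReal (Real.exp ((T + 1 : ℕ) * c)) := by
          rw [← ENNReal.ofReal_mul (Real.exp_nonneg _), ← Real.exp_add]
          push_cast
          ring_nf

/-- Chernoff's bound: Markov's inequality for the exponential of the sum. -/
lemma measure_adapted_sum_ge_le {μ : Measure α} (hZ : ∀ k, Measurable (Z k))
    (hind : iIndepFun Z P) (hlaw : ∀ k, P.map (Z k) = μ) {W : ℕ → (ℕ → α) → β}
    (hW : ∀ k, Measurable (W k)) (hadapted : ∀ k z z', (∀ i < k, z i = z' i) → W k z = W k z')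
    {φ : β → α → ℝ} (hφ : Measurable (Function.uncurry φ)) {t c : ℝ} (ht : 0 ≤ t)
    (hmgf : ∀ k z, ∫⁻ x, ENNReal.ofReal (Real.exp (t * φ (W k z) x)) ∂μ ≤
      ENNReal.ofReal (Real.exp c)) (T : ℕ) (s : ℝ) :
    P {ω | s ≤ ∑ k ∈ Finset.range T, φ (W k fun i => Z i ω) (Z k ω)} ≤
      ENNReal.ofReal (Real.exp (T * c - t * s)) := by
  have hseq : Measurable fun ω i => Z i ω := measurable_pi_lambda _ hZ
  have hsum : Measurable fun ω => ∑ k ∈ Finset.range T, φ (W k fun i => Z i ω) (Z k ω) :=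
    Finset.measurable_fun_sum _ fun k _ => hφ.comp (((hW k).comp hseq).prodMk (hZ k))
  have hle := lintegral_exp_adapted_sum_le hZ hind hlaw hW hadapted hφ hmgf T
  have hmarkov := mul_meas_ge_le_lintegral (μ := P)
    (f := fun ω => ENNReal.ofReal (Real.exp (t * ∑ k ∈ Finset.range T,
      φ (W k fun i => Z i ω) (Z k ω)))) (by fun_prop) (ENNReal.ofReal (Real.exp (t * s)))
  have hsub : {ω | s ≤ ∑ k ∈ Finset.range T, φ (W k fun i => Z i ω) (Z k ω)} ⊆
      {ω | ENNReal.ofReal (Real.exp (t * s)) ≤ ENNReal.ofReal (Real.exp (t *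
        ∑ k ∈ Finset.range T, φ (W k fun i => Z i ω) (Z k ω)))} := fun ω hω => by
    refine ENNReal.ofReal_le_ofReal (Real.exp_le_exp.2 ?_)
    exact mul_le_mul_of_nonneg_left hω ht
  have h := (mul_le_mul_right (measure_mono hsub) (ENNReal.ofReal (Real.exp (t * s)))).trans
    (hmarkov.trans hle)
  have hpos : 0 < Real.exp (t * s) := Real.exp_pos _
  rw [Real.exp_sub, ENNReal.ofReal_div_of_pos hpos,
    ENNReal.le_div_iff_mul_le (Or.inl (by simpa using hpos)) (Or.inl ENNReal.ofReal_ne_top),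
    mul_comm]
  exact h

/-- Hoeffding's lemma for the centered values of a function with `|f| ≤ B`. -/
lemma lintegral_exp_centered_le {μ : Measure α} [IsProbabilityMeasure μ] {f : α → ℝ} {B : ℝ}
    (hB : 0 ≤ B) (hf : Measurable f) (hbound : ∀ᵐ x ∂μ, |f x| ≤ B) (t : ℝ) :
    ∫⁻ x, ENNReal.ofReal (Real.exp (t * (∫ y, f y ∂μ - f x))) ∂μ ≤
      ENNReal.ofReal (Real.exp (B ^ 2 * t ^ 2 / 2)) := by
  have hint : Integrable f μ := Integrable.of_bound hf.aestronglyMeasurable B hbound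
  have h := hasSubgaussianMGF_of_mem_Icc_of_integral_eq_zero (μ := μ)
    (X := fun x => ∫ y, f y ∂μ - f x) (a := ∫ y, f y ∂μ - B) (b := ∫ y, f y ∂μ + B)
    (by fun_prop) (by
      filter_upwards [hbound] with x hx
      obtain ⟨h₁, h₂⟩ := abs_le.1 hx
      constructor <;> linarith)
    (by rw [integral_sub (integrable_const _) hint]; simp)
  rw [← ofReal_integral_eq_lintegral_ofReal (h.integrable_exp_mul t)
    (Filter.Eventually.of_forall fun x => Real.exp_nonneg _)]
  refine ENNReal.ofReal_le_ofReal ((h.mgf_le t).trans_eq ?_)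
  congr 3
  -- The interval has length `2 * B`, so the variance proxy is `B ^ 2`.
  rw [show ∫ y, f y ∂μ + B - (∫ y, f y ∂μ - B) = 2 * B by ring]
  simp [abs_of_nonneg hB]

end Concentration

/-! ### Noisy examples -/

section NoisyExample

variable {d : ℕ} {Dx : Measure (E (Fin d))} {γ η : ℝ} {wstar : E (Fin d)}

lemma measurable_halfspace (w : E (Fin d)) : Measurable (halfspace w) := by
  have hsign : Measurable Real.sign := by
    unfold Real.sign
    exact Measurable.ite measurableSet_Iio measurable_const
      (Measurable.ite measurableSet_Ioi measurable_const measurable_const)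
  exact hsign.comp (by fun_prop)

lemma measurable_prodMk_halfspace (w : E (Fin d)) : Measurable fun x => (x, halfspace w x) :=
  measurable_id.prodMk (measurable_halfspace w)

lemma measurable_prodMk_neg_halfspace (w : E (Fin d)) :
    Measurable fun x => (x, -halfspace w x) :=
  measurable_id.prodMk (measurable_halfspace w).neg

lemma halfspace_eq_of_margin (hγ : 0 < γ) {x : E (Fin d)} (hx : γ < |inner ℝ wstar x|) :
    (γ < inner ℝ wstar x ∧ halfspace wstar x = 1) ∨
      (inner ℝ wstar x < -γ ∧ halfspace wstar x = -1) := by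
  rcases lt_abs.1 hx with h | h
  · exact Or.inl ⟨h, Real.sign_of_pos (hγ.trans h)⟩
  · exact Or.inr ⟨by linarith, Real.sign_of_neg (by linarith)⟩

lemma isProbabilityMeasure_noisyExample [IsProbabilityMeasure Dx] (hη₀ : 0 ≤ η) (hη : η ≤ 1)
    (w : E (Fin d)) : IsProbabilityMeasure (noisyExample Dx w η) := by
  constructor
  rw [noisyExample, Measure.add_apply, Measure.smul_apply, Measure.smul_apply,
    Measure.map_apply (measurable_prodMk_halfspace w) MeasurableSet.univ,
    Measure.map_apply (measurable_prodMk_neg_halfspace w) MeasurableSet.univ]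
  simp only [Set.preimage_univ, measure_univ, smul_eq_mul, mul_one]
  rw [← ENNReal.ofReal_add (by linarith) hη₀]
  simp

lemma ae_noisyExample {r : E (Fin d) × ℝ → Prop} (hr : MeasurableSet {z | r z})
    (h₁ : ∀ᵐ x ∂Dx, r (x, halfspace wstar x)) (h₂ : ∀ᵐ x ∂Dx, r (x, -halfspace wstar x)) :
    ∀ᵐ z ∂(noisyExample Dx wstar η), r z := by
  rw [noisyExample, ae_add_measure_iff]
  exact ⟨Measure.ae_smul_measure
      ((ae_map_iff (measurable_prodMk_halfspace wstar).aemeasurable hr).2 h₁) _,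
    Measure.ae_smul_measure
      ((ae_map_iff (measurable_prodMk_neg_halfspace wstar).aemeasurable hr).2 h₂) _⟩

lemma integral_noisyExample (hη₀ : 0 ≤ η) (hη : η ≤ 1) {f : E (Fin d) × ℝ → ℝ}
    (hf : Measurable f) (h₁ : Integrable (fun x => f (x, halfspace wstar x)) Dx)
    (h₂ : Integrable (fun x => f (x, -halfspace wstar x)) Dx) :
    ∫ z, f z ∂(noisyExample Dx wstar η) =
      ∫ x, ((1 - η) * f (x, halfspace wstar x) + η * f (x, -halfspace wstar x)) ∂Dx := by
  have hm₁ := measurable_prodMk_halfspace wstar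
  have hm₂ := measurable_prodMk_neg_halfspace wstar
  have hi₁ : Integrable f (Dx.map fun x => (x, halfspace wstar x)) :=
    (integrable_map_measure hf.aestronglyMeasurable hm₁.aemeasurable).2 h₁
  have hi₂ : Integrable f (Dx.map fun x => (x, -halfspace wstar x)) :=
    (integrable_map_measure hf.aestronglyMeasurable hm₂.aemeasurable).2 h₂
  rw [noisyExample, integral_add_measure (hi₁.smul_measure ENNReal.ofReal_ne_top)
    (hi₂.smul_measure ENNReal.ofReal_ne_top), integral_smul_measure, integral_smul_measure,
    integral_map hm₁.aemeasurable hf.aestronglyMeasurable,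
    integral_map hm₂.aemeasurable hf.aestronglyMeasurable,
    integral_add (h₁.const_mul _) (h₂.const_mul _), integral_const_mul, integral_const_mul,
    ENNReal.toReal_ofReal (by linarith), ENNReal.toReal_ofReal hη₀, smul_eq_mul, smul_eq_mul]

/-- The margin error is at most the noise rate plus the noiseless margin error. -/
lemma marginError_noisyExample_le [IsProbabilityMeasure Dx] (hη₀ : 0 ≤ η) (hη : η ≤ 1) (τ : ℝ)
    (w : E (Fin d)) :
    marginError (noisyExample Dx wstar η) τ w ≤
      η + Dx.real {x | halfspace wstar x * inner ℝ w x ≤ τ} := by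
  have hS : MeasurableSet {z : E (Fin d) × ℝ | z.2 * inner ℝ w z.1 ≤ τ} :=
    measurableSet_le (by fun_prop) measurable_const
  have hm₁ := measurable_prodMk_halfspace wstar
  have hm₂ := measurable_prodMk_neg_halfspace wstar
  have heq : marginError (noisyExample Dx wstar η) τ w =
      (1 - η) * Dx.real {x | halfspace wstar x * inner ℝ w x ≤ τ} +
        η * Dx.real {x | -halfspace wstar x * inner ℝ w x ≤ τ} := by
    rw [marginError, measureReal_def, noisyExample, Measure.add_apply, Measure.smul_apply,
      Measure.smul_apply, Measure.map_apply hm₁ hS, Measure.map_apply hm₂ hS, smul_eq_mul,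
      smul_eq_mul, ENNReal.toReal_add (by finiteness) (by finiteness), ENNReal.toReal_mul,
      ENNReal.toReal_mul, ENNReal.toReal_ofReal (by linarith), ENNReal.toReal_ofReal hη₀]
    rfl
  rw [heq]
  have h₁ : Dx.real {x | -halfspace wstar x * inner ℝ w x ≤ τ} ≤ 1 := measureReal_le_one
  have h₂ : 0 ≤ Dx.real {x | halfspace wstar x * inner ℝ w x ≤ τ} := measureReal_nonneg
  nlinarith

/-! ### The hinge between the directional loss and the margin error. -/

/-- A convex surrogate for the noiseless margin error. -/
noncomputable def hinge (γ η : ℝ) (wstar w x : E (Fin d)) : ℝ :=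
  (1 - 2 * η) * max 0 (3 / 8 * γ - halfspace wstar x * inner ℝ w x / 2)

lemma hinge_nonneg (hη : η < 1 / 2) (w x : E (Fin d)) : 0 ≤ hinge γ η wstar w x :=
  mul_nonneg (by linarith) (le_max_left _ _)

lemma le_hinge (hη : η < 1 / 2) {w x : E (Fin d)}
    (h : halfspace wstar x * inner ℝ w x ≤ γ / 2) : (1 - 2 * η) * γ / 8 ≤ hinge γ η wstar w x := by
  rw [hinge, mul_div_assoc]
  refine mul_le_mul_of_nonneg_left (le_trans ?_ (le_max_right _ _)) (by linarith)
  linarith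

/-- This symmetry reduces examples on the negative side of `w*` to those on the positive side. -/
lemma link_neg (hγ : 0 < γ) (s : ℝ) : link γ η (-s) = 1 - link γ η s := by
  rw [link_eq_clamp hγ, link_eq_clamp hγ]
  have : max (-γ) (min γ (-s)) = -max (-γ) (min γ s) := by
    rcases le_total s (-γ) with h₁ | h₁
    · rw [min_eq_left (by linarith), max_eq_right (by linarith), min_eq_right (by linarith),
        max_eq_left h₁, neg_neg]
    · rcases le_total γ s with h₂ | h₂
      · rw [min_eq_right (by linarith), max_eq_left (by linarith), min_eq_left h₂,
          max_eq_right (by linarith)]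
      · rw [min_eq_right (by linarith), max_eq_right (by linarith), min_eq_right h₂,
          max_eq_right h₁]
  rw [this]
  ring

/-- For `|s| ≤ γ` the right side is at least `(1 - 2η) (γ - s) ^ 2 / (2γ)`. The line `3γ/8 - s/2` is
the tangent of `(γ - s) ^ 2 / (2γ)` at `s = γ/2`, with value `γ/8` there. -/
lemma hinge_le_link_sub_mul (hγ : 0 < γ) (hη : η < 1 / 2) {s t : ℝ} (ht : γ < t) :
    (1 - 2 * η) * max 0 (3 / 8 * γ - s / 2) ≤ (link γ η s - (1 - η)) * (s - t) := by
  have hη' : 0 < 1 - 2 * η := by linarith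
  rcases le_total γ s with hs | hs
  · rw [max_eq_left (by linarith), mul_zero]
    have : link γ η s = 1 - η := by
      rw [link_eq_clamp hγ, min_eq_left hs, max_eq_right (by linarith)]
      field_simp
      ring
    rw [this, sub_self, zero_mul]
  -- The gap to the upper plateau grows linearly with `γ - s`, until the lower plateau caps it at
  -- distance `2γ`.
  have hgap : (1 - 2 * η) * (min (γ - s) (2 * γ) / (2 * γ)) = 1 - η - link γ η s := by
    rw [link_eq_clamp hγ, min_eq_right hs]
    rcases le_total (-γ) s with h | h
    · rw [max_eq_right h, min_eq_left (by linarith)]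
      field_simp
      ring
    · rw [max_eq_left h, min_eq_right (by linarith)]
      field_simp
      ring
  have hrw : (link γ η s - (1 - η)) * (s - t) =
      (1 - 2 * η) * (min (γ - s) (2 * γ) / (2 * γ) * (t - s)) := by
    rw [← mul_assoc, hgap]
    ring
  rw [hrw]
  refine mul_le_mul_of_nonneg_left ?_ hη'.le
  have hm₀ : 0 ≤ min (γ - s) (2 * γ) := le_min (by linarith) (by linarith)
  refine le_trans (max_le (by positivity) ?_) (mul_le_mul_of_nonneg_left
    (by linarith : γ - s ≤ t - s) (by positivity))
  rw [div_mul_eq_mul_div _ (2 * γ), le_div_iff₀ (by linarith)]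
  rcases le_total (γ - s) (2 * γ) with h | h
  · rw [min_eq_left h]
    nlinarith [sq_nonneg (γ - s - γ / 2)]
  · rw [min_eq_right h]
    nlinarith

/-- The conditional expectation of the directional loss dominates the surrogate. -/
lemma hinge_le_directionalLoss (hγ : 0 < γ) (hη : η < 1 / 2) {x : E (Fin d)}
    (hx : γ < |inner ℝ wstar x|) (w : E (Fin d)) :
    hinge γ η wstar w x ≤ (1 - η) * directionalLoss γ η wstar w (x, halfspace wstar x) +
      η * directionalLoss γ η wstar w (x, -halfspace wstar x) := by
  simp only [hinge, directionalLoss, residual]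
  rcases halfspace_eq_of_margin hγ hx with ⟨h₁, h₂⟩ | ⟨h₁, h₂⟩
  · rw [h₂, one_mul]
    -- Averaging over the noise: `(1 - η) (u - 1) + η u = u - (1 - η)`.
    refine (hinge_le_link_sub_mul hγ hη h₁).trans_eq ?_
    ring
  · rw [h₂]
    have h := hinge_le_link_sub_mul hγ hη (s := -inner ℝ w x) (by linarith : γ < -inner ℝ wstar x)
    rw [link_neg hγ] at h
    rw [neg_one_mul]
    refine h.trans_eq ?_
    ring

/-- Jensen's inequality, the reason for introducing the hinge: `(u(s) - (1 - η)) (s - t)` itself is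
not convex in `s`, its slope dropping at `s = -γ`. -/
lemma hinge_average_le (hη : η < 1 / 2) {T : ℕ} (hT : 0 < T) (W : ℕ → E (Fin d))
    (x : E (Fin d)) :
    hinge γ η wstar ((T : ℝ)⁻¹ • ∑ k ∈ Finset.range T, W k) x ≤
      (T : ℝ)⁻¹ * ∑ k ∈ Finset.range T, hinge γ η wstar (W k) x := by
  have hT' : (0 : ℝ) < T := by exact_mod_cast hT
  simp only [hinge]
  rw [← Finset.mul_sum, mul_left_comm]
  refine mul_le_mul_of_nonneg_left (max_le ?_ ?_) (by linarith)
  · exact mul_nonneg (by positivity) (Finset.sum_nonneg fun k _ => le_max_left _ _)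
  · have h := Finset.sum_le_sum fun k (_ : k ∈ Finset.range T) =>
      le_max_right 0 (3 / 8 * γ - halfspace wstar x * inner ℝ (W k) x / 2)
    refine le_trans (le_of_eq ?_) (mul_le_mul_of_nonneg_left h (inv_nonneg.2 hT'.le))
    rw [inner_smul_left, sum_inner, Finset.sum_sub_distrib, ← Finset.sum_div,
      ← Finset.mul_sum (Finset.range T) _ (halfspace wstar x)]
    simp only [Finset.sum_const, Finset.card_range, nsmul_eq_mul, conj_trivial]
    field_simp

variable {p q : ℝ≥0∞}

lemma measurable_directionalLoss (hγ : 0 < γ) (wstar : E (Fin d)) :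
    Measurable (Function.uncurry (directionalLoss γ η wstar)) := by
  have h := (measurable_residual η hγ).comp
    (show Measurable fun x : E (Fin d) × (E (Fin d) × ℝ) => ((inner ℝ x.1 x.2.1 : ℝ), x.2.2) by
      fun_prop)
  exact h.mul (by fun_prop)

lemma abs_directionalLoss_le (h : ENNReal.HolderConjugate p q) (hγ : 0 < γ) (hη₀ : 0 ≤ η)
    (hη : η < 1 / 2) (hstar : vecNorm q wstar ≤ 1) {w : E (Fin d)} (hw : vecNorm q w ≤ 1)
    {z : E (Fin d) × ℝ} (hz : vecNorm p z.1 ≤ 1) (hy : z.2 = 1 ∨ z.2 = -1) :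
    |directionalLoss γ η wstar w z| ≤ 2 := by
  have : Fact (1 ≤ p) := ⟨ENNReal.HolderConjugate.one_le p q⟩
  have hin : ∀ v : E (Fin d), vecNorm q v ≤ 1 → |inner ℝ v z.1| ≤ 1 := fun v hv =>
    (abs_inner_le_vecNorm_mul_vecNorm h v z.1).trans (mul_le_one₀ hv (vecNorm_nonneg _) hz)
  rw [directionalLoss, abs_mul]
  have h₁ := abs_residual_le_one hγ hη₀ hη hy (inner ℝ w z.1)
  have h₂ := (abs_sub (inner ℝ w z.1) (inner ℝ wstar z.1)).trans
    (add_le_add (hin w hw) (hin wstar hstar))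
  exact (mul_le_of_le_one_left (abs_nonneg _) h₁).trans (h₂.trans_eq (by norm_num))

lemma measurable_hinge (wstar w : E (Fin d)) : Measurable (hinge γ η wstar w) := by
  have := measurable_halfspace wstar
  unfold hinge
  fun_prop

lemma abs_halfspace_le_one (w x : E (Fin d)) : |halfspace w x| ≤ 1 := by
  rcases Real.sign_apply_eq (inner ℝ w x) with h | h | h <;> simp [halfspace, h]

lemma integrable_hinge [IsProbabilityMeasure Dx] (h : ENNReal.HolderConjugate p q) (hγ : 0 < γ)
    (hη : η < 1 / 2) (hball : ∀ᵐ x ∂Dx, vecNorm p x ≤ 1) {w : E (Fin d)}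
    (hw : vecNorm q w ≤ 1) : Integrable (hinge γ η wstar w) Dx := by
  have : Fact (1 ≤ p) := ⟨ENNReal.HolderConjugate.one_le p q⟩
  refine Integrable.of_bound (measurable_hinge wstar w).aestronglyMeasurable
    ((1 - 2 * η) * (γ + 1)) ?_
  filter_upwards [hball] with x hx
  have h₁ := (abs_inner_le_vecNorm_mul_vecNorm h w x).trans
    (mul_le_one₀ hw (vecNorm_nonneg _) hx)
  have h₂ : |halfspace wstar x * inner ℝ w x| ≤ 1 := by
    rw [abs_mul]
    exact mul_le_one₀ (abs_halfspace_le_one _ _) (abs_nonneg _) h₁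
  rw [Real.norm_of_nonneg (hinge_nonneg hη w x), hinge]
  refine mul_le_mul_of_nonneg_left (max_le (by linarith) ?_) (by linarith)
  linarith [(abs_le.1 h₂).1]

lemma ae_noisyExample_bounded (h : ENNReal.HolderConjugate p q) (hγ : 0 < γ)
    (hball : ∀ᵐ x ∂Dx, vecNorm p x ≤ 1) (hmargin : ∀ᵐ x ∂Dx, γ < |inner ℝ wstar x|) :
    ∀ᵐ z ∂(noisyExample Dx wstar η), vecNorm p z.1 ≤ 1 ∧ (z.2 = 1 ∨ z.2 = -1) := by
  have : Fact (1 ≤ p) := ⟨ENNReal.HolderConjugate.one_le p q⟩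
  refine ae_noisyExample ?_ ?_ ?_
  · have hN : Measurable (vecNorm p : E (Fin d) → ℝ) := continuous_vecNorm.measurable
    exact (measurableSet_le (hN.comp measurable_fst) measurable_const).inter
      ((measurableSet_eq_fun measurable_snd measurable_const).union
        (measurableSet_eq_fun measurable_snd measurable_const))
  all_goals
    filter_upwards [hball, hmargin] with x hx hm
    refine ⟨hx, ?_⟩
    rcases halfspace_eq_of_margin hγ hm with ⟨-, h⟩ | ⟨-, h⟩ <;> simp [h]

lemma integral_hinge_le [IsProbabilityMeasure Dx] (h : ENNReal.HolderConjugate p q) (hγ : 0 < γ)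
    (hη₀ : 0 ≤ η) (hη : η < 1 / 2) (hball : ∀ᵐ x ∂Dx, vecNorm p x ≤ 1)
    (hmargin : ∀ᵐ x ∂Dx, γ < |inner ℝ wstar x|) (hstar : vecNorm q wstar ≤ 1) {w : E (Fin d)}
    (hw : vecNorm q w ≤ 1) :
    ∫ x, hinge γ η wstar w x ∂Dx ≤
      ∫ z, directionalLoss γ η wstar w z ∂(noisyExample Dx wstar η) := by
  have hm : Measurable (directionalLoss γ η wstar w) :=
    (measurable_directionalLoss hγ wstar).of_uncurry_left
  have hi₁ : Integrable (fun x => directionalLoss γ η wstar w (x, halfspace wstar x)) Dx := by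
    refine Integrable.of_bound
      (hm.comp (measurable_prodMk_halfspace wstar)).aestronglyMeasurable 2 ?_
    filter_upwards [hball, hmargin] with x hx hmx
    refine abs_directionalLoss_le h hγ hη₀ hη hstar hw hx ?_
    rcases halfspace_eq_of_margin hγ hmx with ⟨-, h⟩ | ⟨-, h⟩ <;> simp [h]
  have hi₂ : Integrable (fun x => directionalLoss γ η wstar w (x, -halfspace wstar x)) Dx := by
    refine Integrable.of_bound
      (hm.comp (measurable_prodMk_neg_halfspace wstar)).aestronglyMeasurable 2 ?_
    filter_upwards [hball, hmargin] with x hx hmx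
    refine abs_directionalLoss_le h hγ hη₀ hη hstar hw hx ?_
    rcases halfspace_eq_of_margin hγ hmx with ⟨-, h⟩ | ⟨-, h⟩ <;> simp [h]
  rw [integral_noisyExample hη₀ (by linarith) hm hi₁ hi₂]
  refine integral_mono_ae (integrable_hinge h hγ hη hball hw)
    ((hi₁.const_mul _).add (hi₂.const_mul _)) ?_
  filter_upwards [hmargin] with x hx
  exact hinge_le_directionalLoss hγ hη hx w

/-- A small average directional loss of the iterates bounds the margin error of their average. -/
lemma marginError_average_le [IsProbabilityMeasure Dx] (h : ENNReal.HolderConjugate p q)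
    (hγ : 0 < γ) (hη₀ : 0 ≤ η) (hη : η < 1 / 2) (hball : ∀ᵐ x ∂Dx, vecNorm p x ≤ 1)
    (hmargin : ∀ᵐ x ∂Dx, γ < |inner ℝ wstar x|) (hstar : vecNorm q wstar ≤ 1) {T : ℕ}
    (hT : 0 < T) {W : ℕ → E (Fin d)} (hW : ∀ k, vecNorm q (W k) ≤ 1) {ε : ℝ}
    (hloss : ∑ k ∈ Finset.range T,
      ∫ z, directionalLoss γ η wstar (W k) z ∂(noisyExample Dx wstar η) ≤
        T * (ε * γ * (1 - 2 * η) / 8)) :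
    marginError (noisyExample Dx wstar η) (γ / 2) ((T : ℝ)⁻¹ • ∑ k ∈ Finset.range T, W k) ≤
      η + ε := by
  have : Fact (1 ≤ q) := ⟨ENNReal.HolderConjugate.one_le q p⟩
  have hT' : (0 : ℝ) < T := by exact_mod_cast hT
  set w := (T : ℝ)⁻¹ • ∑ k ∈ Finset.range T, W k with hw
  have hwn : vecNorm q w ≤ 1 := vecNorm_average_le_one hW
  have hsum : ∫ x, hinge γ η wstar w x ∂Dx ≤ ε * γ * (1 - 2 * η) / 8 := by
    calc ∫ x, hinge γ η wstar w x ∂Dx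
        ≤ ∫ x, (T : ℝ)⁻¹ * ∑ k ∈ Finset.range T, hinge γ η wstar (W k) x ∂Dx :=
          integral_mono (integrable_hinge h hγ hη hball hwn)
            ((integrable_finsetSum _ fun k _ => integrable_hinge h hγ hη hball (hW k)).const_mul _)
            fun x => hinge_average_le hη hT W x
      _ = (T : ℝ)⁻¹ * ∑ k ∈ Finset.range T, ∫ x, hinge γ η wstar (W k) x ∂Dx := by
          rw [integral_const_mul, integral_finsetSum _ fun k _ =>
            integrable_hinge h hγ hη hball (hW k)]
      _ ≤ (T : ℝ)⁻¹ * (T * (ε * γ * (1 - 2 * η) / 8)) := by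
          gcongr
          exact (Finset.sum_le_sum fun k _ =>
            integral_hinge_le h hγ hη₀ hη hball hmargin hstar (hW k)).trans hloss
      _ = _ := inv_mul_cancel_left₀ hT'.ne' _
  have hc : 0 < (1 - 2 * η) * γ / 8 := by
    have : 0 < 1 - 2 * η := by linarith
    positivity
  -- Markov's inequality at the height that `le_hinge` guarantees on the margin violations.
  have hmarkov := mul_meas_ge_le_integral_of_nonneg
    (f := hinge γ η wstar w) (Filter.Eventually.of_forall fun x => hinge_nonneg hη w x)
    (integrable_hinge h hγ hη hball hwn) ((1 - 2 * η) * γ / 8)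
  have hmono : Dx.real {x | halfspace wstar x * inner ℝ w x ≤ γ / 2} ≤
      Dx.real {x | (1 - 2 * η) * γ / 8 ≤ hinge γ η wstar w x} :=
    measureReal_mono fun x hx => le_hinge hη hx
  have hle : Dx.real {x | halfspace wstar x * inner ℝ w x ≤ γ / 2} ≤ ε := by
    refine hmono.trans (le_of_mul_le_mul_left (hmarkov.trans (hsum.trans_eq ?_)) hc)
    ring
  linarith [marginError_noisyExample_le (Dx := Dx) (wstar := wstar) hη₀ (by linarith) (γ / 2) w]

end NoisyExample

/-! ### Sample complexity -/

/-- With probability `1 - exp (-T * e ^ 2 / 32)` the iterates have small average expected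
directional loss, provided that their regret is small. -/
lemma measure_not_small_loss_le {d : ℕ} {p q : ℝ≥0∞} (h : ENNReal.HolderConjugate p q)
    {γ η a D b : ℝ} (hγ : 0 < γ) (hη₀ : 0 ≤ η) (hη : η < 1 / 2)
    {W : ℕ → (ℕ → E (Fin d) × ℝ) → E (Fin d)} (hW : IsRegretBounded p q γ η a D b W)
    {Dx : Measure (E (Fin d))} [IsProbabilityMeasure Dx] {wstar : E (Fin d)}
    (hball : ∀ᵐ x ∂Dx, vecNorm p x ≤ 1) (hstar : vecNorm q wstar = 1)
    (hmargin : ∀ᵐ x ∂Dx, γ < |inner ℝ wstar x|)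
    {Ω : Type} [MeasurableSpace Ω] {P : Measure Ω} [IsProbabilityMeasure P]
    {Z : ℕ → Ω → E (Fin d) × ℝ} (hZ : ∀ k, Measurable (Z k)) (hind : iIndepFun Z P)
    (hlaw : ∀ k, P.map (Z k) = noisyExample Dx wstar η) {T : ℕ} {e : ℝ} (he : 0 ≤ e)
    (hreg : D + T * b ≤ T * (e / 2)) :
    P {ω | ¬ ∑ k ∈ Finset.range T, ∫ z, directionalLoss γ η wstar (W k fun i => Z i ω) z
        ∂(noisyExample Dx wstar η) ≤ T * e} ≤ ENNReal.ofReal (Real.exp (-(T * e ^ 2 / 32))) := by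
  have hprob := isProbabilityMeasure_noisyExample (Dx := Dx) hη₀ (by linarith) wstar
  set μ := noisyExample Dx wstar η with hμ
  have hae := ae_noisyExample_bounded (η := η) h hγ hball hmargin
  have hdm := measurable_directionalLoss (η := η) hγ wstar
  have hφ : Measurable (Function.uncurry fun (w : E (Fin d)) (z : E (Fin d) × ℝ) =>
      ∫ y, directionalLoss γ η wstar w y ∂μ - directionalLoss γ η wstar w z) := by
    have hint : Measurable fun w => ∫ y, directionalLoss γ η wstar w y ∂μ :=
      hdm.stronglyMeasurable.integral_prod_right.measurable
    exact (hint.comp measurable_fst).sub hdm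
  -- The parameter `e / 8` minimizes `T * (2 * t ^ 2) - t * (T * (e / 2))`, with minimum `-(T * e ^
  -- 2 / 32)`.
  have hconc := measure_adapted_sum_ge_le hZ hind hlaw hW.measurable hW.adapted hφ
    (t := e / 8) (c := 2 ^ 2 * (e / 8) ^ 2 / 2) (by positivity)
    (fun k z => lintegral_exp_centered_le zero_le_two hdm.of_uncurry_left (by
      filter_upwards [hae] with x hx
      exact abs_directionalLoss_le h hγ hη₀ hη hstar.le (hW.vecNorm_le_one k z) hx.1 hx.2) _)
    T (T * (e / 2))
  rw [show T * (2 ^ 2 * (e / 8) ^ 2 / 2) - e / 8 * (T * (e / 2)) = -(T * e ^ 2 / 32) by ring]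
    at hconc
  refine le_trans (measure_mono_ae ?_) hconc
  have hgood : ∀ᵐ ω ∂P, ∀ k, vecNorm p (Z k ω).1 ≤ 1 ∧ ((Z k ω).2 = 1 ∨ (Z k ω).2 = -1) := by
    refine ae_all_iff.2 fun k => ?_
    rw [← hμ, ← hlaw k] at hae
    exact ae_of_ae_map (hZ k).aemeasurable hae
  -- If the expected losses sum to more than `T * e` while the regret is at most `T * (e / 2)`, the
  -- centered sum exceeds `T * (e / 2)`.
  filter_upwards [hgood] with ω hω hlarge
  have hr := hW.regret wstar hstar T (fun i => Z i ω) hω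
  have hlarge' := not_le.1 hlarge
  change T * (e / 2) ≤ _
  rw [Finset.sum_sub_distrib]
  linarith

/-- Here `x` plays the role of `ε γ (1 - 2η)` and `x / 8` is the target average loss; half of it is
allotted to the regret and half to the deviation. -/
lemma exists_step_size {M D t : ℝ} (hM : 1 ≤ M) (hD : 1 ≤ D) (ht₀ : 0 < t) (ht₁ : t ≤ 1) :
    ∃ C : ℝ, 0 < C ∧ ∀ x δ : ℝ, 0 < x → x ≤ 1 → 0 < δ → δ < 1 → ∀ T : ℕ,
      C * Real.log (2 / δ) / x ^ (1 + 1 / t) ≤ T →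
      ∃ a : ℝ, 0 < a ∧ a ≤ 1 ∧ D / a + T * (M * a ^ t) ≤ T * (x / 8 / 2) ∧
        Real.exp (-(T * (x / 8) ^ 2 / 32)) ≤ δ := by
  set r := 1 + 1 / t with hr
  have hr₂ : 2 ≤ r := by
    have : 1 ≤ 1 / t := (one_le_div ht₀).2 ht₁
    linarith
  have hK : 0 < 64 * D * (32 * M) ^ (1 / t) := by positivity
  -- The first summand pays for the regret, `64` being `32` doubled because `log (2 / δ) ≥ 1 / 2`.
  -- The second pays for the deviation: `2048 = 8 ^ 2 * 32`.
  refine ⟨64 * D * (32 * M) ^ (1 / t) + 2048, by linarith, fun x δ hx₀ hx₁ hδ₀ hδ₁ T hT => ?_⟩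
  have hlog : Real.log (2 / δ) = Real.log 2 - Real.log δ := Real.log_div two_ne_zero hδ₀.ne'
  have hlogδ : Real.log δ < 0 := Real.log_neg hδ₀ hδ₁
  have hlog₂ := Real.log_two_gt_d9
  have hL : 1 / 2 ≤ Real.log (2 / δ) := by linarith
  have hxr : 0 < x ^ r := Real.rpow_pos_of_pos hx₀ r
  rw [div_le_iff₀ hxr, add_mul] at hT
  have hT₀ : (0 : ℝ) ≤ T := Nat.cast_nonneg T
  -- This step size makes `M * a ^ t` equal to `x / 32`, half of the regret budget `x / 16`.
  refine ⟨(x / (32 * M)) ^ (1 / t), by positivity, ?_, ?_, ?_⟩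
  · refine Real.rpow_le_one (by positivity) ?_ (by positivity)
    rw [div_le_one (by linarith)]
    linarith
  · have hat : ((x / (32 * M)) ^ (1 / t)) ^ t = x / (32 * M) := by
      rw [← Real.rpow_mul (by positivity), one_div_mul_cancel ht₀.ne', Real.rpow_one]
    have h₁ : M * ((x / (32 * M)) ^ (1 / t)) ^ t = x / 32 := by
      rw [hat]
      field_simp
    have h₂ : D / (x / (32 * M)) ^ (1 / t) ≤ T * (x / 32) := by
      rw [div_le_iff₀ (by positivity), Real.div_rpow hx₀.le (by positivity)]
      have hxr' : x ^ r = x * x ^ (1 / t) := by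
        rw [hr, Real.rpow_add hx₀, Real.rpow_one]
      have h₃ : 32 * D * (32 * M) ^ (1 / t) ≤ T * x ^ r := by
        have := mul_le_mul_of_nonneg_left hL hK.le
        linarith
      have h₄ : T * (x / 32) * (x ^ (1 / t) / (32 * M) ^ (1 / t)) =
          T * x ^ r / (32 * (32 * M) ^ (1 / t)) := by
        rw [hxr']
        field_simp
      rw [h₄, le_div_iff₀ (by positivity)]
      linarith
    rw [h₁]
    linarith
  · rw [← Real.le_log_iff_exp_le hδ₀]
    have h₁ : x ^ r ≤ x ^ 2 := by
      rw [← Real.rpow_natCast]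
      exact Real.rpow_le_rpow_of_exponent_ge hx₀ hx₁ (by exact_mod_cast hr₂)
    have h₂ := mul_le_mul_of_nonneg_left h₁ hT₀
    have h₃ := mul_nonneg hK.le (by linarith : 0 ≤ Real.log (2 / δ))
    linarith

end RobustHalfspace

theorem theorem5 (d : ℕ) (p q : ℝ≥0∞) (hpq : ENNReal.HolderConjugate p q) :
    (∀ γ η : ℝ, 0 < γ → 0 ≤ η → η < 1 / 2 → ∀ z : RobustHalfspace.E (Fin d) × ℝ,
      ConvexOn ℝ Set.univ (fun w => RobustHalfspace.glmLoss γ η w z)) ∧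
    ∃ C : ℝ, 0 < C ∧
      ∀ γ η ε δ : ℝ, 0 < γ → 0 ≤ η → η < 1 / 2 → 0 < ε → 0 < δ → δ < 1 →
      ∀ T : ℕ,
        C * Real.log (2 / δ) / (ε * γ * (1 - 2 * η)) ^ RobustHalfspace.rateExponent q ≤ (T : ℝ) →
      ∃ a : ℝ, 0 < a ∧
        ∀ (Dx : Measure (RobustHalfspace.E (Fin d))) [IsProbabilityMeasure Dx]
          (wstar : RobustHalfspace.E (Fin d)),
          (∀ᵐ x ∂Dx, RobustHalfspace.vecNorm p x ≤ 1) →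
          RobustHalfspace.vecNorm q wstar = 1 →
          (∀ᵐ x ∂Dx, γ < |inner ℝ wstar x|) →
        ∀ (Ω : Type) [MeasurableSpace Ω] (P : Measure Ω) [IsProbabilityMeasure P]
          (Z : ℕ → Ω → RobustHalfspace.E (Fin d) × ℝ),
          (∀ k, Measurable (Z k)) → iIndepFun Z P →
          (∀ k, P.map (Z k) = RobustHalfspace.noisyExample Dx wstar η) →
          P {ω | ¬ (RobustHalfspace.vecNorm q
                (RobustHalfspace.smdHalfspace q γ η a T (fun k => Z k ω)) ≤ 1 ∧
              RobustHalfspace.marginError (RobustHalfspace.noisyExample Dx wstar η) (γ / 2)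
                (RobustHalfspace.smdHalfspace q γ η a T (fun k => Z k ω)) ≤ η + ε)}
            ≤ ENNReal.ofReal δ := by
  refine ⟨fun γ η hγ _ hη z => RobustHalfspace.convexOn_glmLoss hγ hη z, ?_⟩
  have : Fact (1 ≤ q) := ⟨ENNReal.HolderConjugate.one_le q p⟩
  obtain ⟨M, D, t, hM, hD, ht₀, ht₁, hrate, hsmd⟩ :=
    RobustHalfspace.exists_isRegretBounded d hpq
  obtain ⟨C, hC, hstep⟩ := RobustHalfspace.exists_step_size hM hD ht₀ ht₁
  rw [hrate] at hstep
  refine ⟨C, hC, fun γ η ε δ hγ hη₀ hη hε hδ₀ hδ₁ T hT => ?_⟩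
  have hη' : 0 < 1 - 2 * η := by linarith
  have hx₀ : 0 < ε * γ * (1 - 2 * η) := by positivity
  have hT₀ : 0 < T := by
    have hlog : 0 < Real.log (2 / δ) := Real.log_pos (by rw [lt_div_iff₀ hδ₀]; linarith)
    have h : (0 : ℝ) < T := lt_of_lt_of_le (by positivity) hT
    exact_mod_cast h
  -- The step size analysis needs accuracy at most `1`. Otherwise the data force `γ < 1`, hence `ε ≥
  -- 1`, and the error bound is trivial for any step size.
  by_cases hx₁ : ε * γ * (1 - 2 * η) ≤ 1
  · obtain ⟨a, ha₀, ha₁, hreg, hexp⟩ := hstep _ δ hx₀ hx₁ hδ₀ hδ₁ T hT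
    obtain ⟨W, hW⟩ := hsmd γ η a hγ hη₀ hη ha₀ ha₁
    refine ⟨a, ha₀, fun Dx _ wstar hball hstar hmargin Ω _ P _ Z hZ hind hlaw => ?_⟩
    refine (measure_mono ?_).trans ((RobustHalfspace.measure_not_small_loss_le hpq hγ hη₀ hη hW
      hball hstar hmargin hZ hind hlaw (by positivity) hreg).trans (ENNReal.ofReal_le_ofReal hexp))
    intro ω hω hsmall
    refine hω ?_
    rw [hW.average]
    exact ⟨RobustHalfspace.vecNorm_average_le_one fun k => hW.vecNorm_le_one k _,
      RobustHalfspace.marginError_average_le hpq hγ hη₀ hη hball hmargin hstar.le hT₀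
        (fun k => hW.vecNorm_le_one k _) hsmall⟩
  · obtain ⟨W, hW⟩ := hsmd γ η 1 hγ hη₀ hη one_pos le_rfl
    refine ⟨1, one_pos, fun Dx _ wstar hball hstar hmargin Ω _ P _ Z hZ hind hlaw => ?_⟩
    have hγ₁ : γ < 1 := by
      -- Some point satisfies both almost sure conditions, and Hölder's inequality there gives `γ <
      -- |⟨w*, x⟩| ≤ 1`.
      obtain ⟨x, hx, hm⟩ := (hball.and hmargin).exists
      have := RobustHalfspace.abs_inner_le_vecNorm_mul_vecNorm hpq wstar x
      rw [hstar, one_mul] at this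
      linarith
    have hε₁ : 1 ≤ ε := by
      by_contra! hlt
      have h₁ : ε * γ ≤ 1 := mul_le_one₀ hlt.le hγ.le hγ₁.le
      exact hx₁ (mul_le_one₀ h₁ hη'.le (by linarith))
    have hprob := RobustHalfspace.isProbabilityMeasure_noisyExample (Dx := Dx) hη₀
      (by linarith) wstar
    refine (measure_mono (t := ∅) fun ω hω => (hω ?_).elim).trans (by simp)
    rw [hW.average]
    refine ⟨RobustHalfspace.vecNorm_average_le_one fun k => hW.vecNorm_le_one k _, ?_⟩
    have : RobustHalfspace.marginError (RobustHalfspace.noisyExample Dx wstar η) (γ / 2)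
        ((T : ℝ)⁻¹ • ∑ k ∈ Finset.range T, W k fun k => Z k ω) ≤ 1 := measureReal_le_one
    linarith
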